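/- Let $\mathcal D$ be a probability distribution on $[0,\infty)$ with cumulative distribution function $F$ and a density $f$, and let $x^*\le\infty$ be the right endpoint of its support. Assume that $\mathcal D$ has monotone hazard rate (MHR), i.e. (for a suitable version of $f$) $h(x)=\frac{f(x)}{1-F(x)}$ is non-decreasing on $[0,x^*)$. Let $\gamma\in\mathbb R$. We say that $\mathcal D\in D_\gamma$ for maxima if there are $a_n>0$, $b_n\in\mathbb R$ such that for all $x$ with $1+\gamma x>0$, $\lim_{n\to\infty}F(a_nx+b_n)^n=\exp\left(-(1+\gamma x)^{-1/\gamma}\right)$ (to be read as $\exp(-e^{-x})$ if $\gamma=0$), and that $\mathcal D\in D_\gamma$ for minima if there are $a_n>0$, $b_n\in\mathbb R$ such that for all $x$ with $1-\gamma x>0$, $\lim_{n\to\infty}(1-F(a_nx+b_n))^n=\exp\left(-(1-\gamma x)^{-1/\gamma}\right)$ (to be read as $\exp(-e^{x})$ if $\gamma=0$). Let $X_1,X_2,\dots$ be i.i.d. with law $\mathcal D$. Let $G_M(n)$ be the supremum, over thresholds $\tau_1,\dots,\tau_n\in\mathbb R$, of the expected reward of the policy that observes $X_1,\dots,X_n$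 one by one and accepts the first $X_i\ge\tau_i$ (with reward $0$ if nothing is accepted). Let $G_m(n)$ be the infimum, over thresholds $\tau_1,\dots,\tau_n\in\mathbb R$, of the expected cost of the policy that accepts the first $X_i\le\tau_i$ and has to accept $X_n$ if it has accepted nothing before. Then: 1. If $\mathcal D\in D_\gamma$ for maxima, then $\gamma\le 0$, and $\displaystyle\lim_{n\to\infty}\frac{G_M(n)}{\mathbb E[\max(X_1,\dots,X_n)]}=1$. 2. If $\mathcal D\in D_\gamma$ for minima, then $\gamma\ge -1$, and $\displaystyle\lim_{n\to\infty}\frac{G_m(n)}{\mathbb E[\min(X_1,\dots,X_n)]}$ exists and is at most $2$. -/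

import Mathlib

open MeasureTheory ProbabilityTheory Filter Topology
open scoped ENNReal

namespace ProphetMHR

/-- `f` is (a version of) the probability density function of `μ`. -/
structure IsDensity (μ : Measure ℝ) (f : ℝ → ℝ) : Prop where
  measurable : Measurable f
  nonneg : ∀ x, 0 ≤ f x
  eq_withDensity : μ = volume.withDensity (fun x => ENNReal.ofReal (f x))

/-- The (maxima) hazard rate `h = f / (1 - F)` of the distribution `μ` with density `f`. -/
noncomputable def hazardRate (μ : Measure ℝ) (f : ℝ → ℝ) (x : ℝ) : ℝ :=
  f x / (1 - cdf μ x)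

/-- Monotone hazard rate distributions: distributions of nonnegative random variables that have
a density for which the hazard rate is non-decreasing on
`[0, x^*) = {x | 0 ≤ x ∧ F x < 1}`, where `x^* ≤ ∞` is the right end of the support. -/
def IsMHR (μ : Measure ℝ) : Prop :=
  μ (Set.Iio 0) = 0 ∧
    ∃ f : ℝ → ℝ, IsDensity μ f ∧
      MonotoneOn (hazardRate μ f) {x | 0 ≤ x ∧ cdf μ x < 1}

/-- The extreme value distribution function for maxima, for `0 < 1 + γ * x`. -/
noncomputable def evMax (γ x : ℝ) : ℝ :=
  if γ = 0 then Real.exp (-Real.exp (-x)) else Real.exp (-(1 + γ * x) ^ (-1 / γ))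

/-- The limiting survival function for minima, for `0 < 1 - γ * x`. -/
noncomputable def evMin (γ x : ℝ) : ℝ :=
  if γ = 0 then Real.exp (-Real.exp x) else Real.exp (-(1 - γ * x) ^ (-1 / γ))

/-- `μ` is in the domain of attraction of `D_γ` for maxima. -/
def InMaxDomain (μ : Measure ℝ) (γ : ℝ) : Prop :=
  ∃ a b : ℕ → ℝ, (∀ n, 0 < a n) ∧
    ∀ x : ℝ, 0 < 1 + γ * x →
      Tendsto (fun n : ℕ => (cdf μ (a n * x + b n)) ^ n) atTop (𝓝 (evMax γ x))

/-- `μ` is in the domain of attraction of `D_γ` for minima. -/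
def InMinDomain (μ : Measure ℝ) (γ : ℝ) : Prop :=
  ∃ a b : ℕ → ℝ, (∀ n, 0 < a n) ∧
    ∀ x : ℝ, 0 < 1 - γ * x →
      Tendsto (fun n : ℕ => (1 - cdf μ (a n * x + b n)) ^ n) atTop (𝓝 (evMin γ x))

/-- Realized reward, in the maximization problem, of the policy with thresholds `t`: accept the
first `x i` with `t i ≤ x i`; the reward is `0` if nothing is accepted. -/
noncomputable def maxReward : (n : ℕ) → (Fin n → ℝ) → (Fin n → ℝ) → ℝ
  | 0, _, _ => 0
  | n + 1, t, x => if t 0 ≤ x 0 then x 0 else maxReward n (Fin.tail t) (Fin.tail x)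

/-- Realized cost, in the minimization problem, of the policy with thresholds `t`: accept the
first `x i` with `x i ≤ t i`, where the last value has to be accepted if it is reached.
(The value for `n = 0` is irrelevant.) -/
noncomputable def minCost : (n : ℕ) → (Fin n → ℝ) → (Fin n → ℝ) → ℝ
  | 0, _, _ => 0
  | 1, _, x => x 0
  | n + 2, t, x => if x 0 ≤ t 0 then x 0 else minCost (n + 1) (Fin.tail t) (Fin.tail x)

/-- `G_M(n)`: the expected reward of the optimal threshold policy, with `n` i.i.d. draws from a
distribution `μ` of nonnegative random variables. -/
noncomputable def optMax (μ : Measure ℝ) (n : ℕ) : ℝ≥0∞ :=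
  ⨆ t : Fin n → ℝ, ∫⁻ x, ENNReal.ofReal (maxReward n t x) ∂(Measure.pi fun _ : Fin n => μ)

/-- `G_m(n)`: the expected cost of the optimal threshold policy, with `n` i.i.d. draws. -/
noncomputable def optMin (μ : Measure ℝ) (n : ℕ) : ℝ≥0∞ :=
  ⨅ t : Fin n → ℝ, ∫⁻ x, ENNReal.ofReal (minCost n t x) ∂(Measure.pi fun _ : Fin n => μ)

/-- The prophet's value `E[max (X_1, …, X_n)]`. -/
noncomputable def prophetMax (μ : Measure ℝ) (n : ℕ) : ℝ≥0∞ :=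
  ∫⁻ x, ⨆ i, ENNReal.ofReal (x i) ∂(Measure.pi fun _ : Fin n => μ)

/-- The prophet's value `E[min (X_1, …, X_n)]`. -/
noncomputable def prophetMin (μ : Measure ℝ) (n : ℕ) : ℝ≥0∞ :=
  ∫⁻ x, ⨅ i, ENNReal.ofReal (x i) ∂(Measure.pi fun _ : Fin n => μ)

/-- `l` is the asymptotic competitive ratio of the i.i.d. max-prophet inequality. -/
def IsMaxACR (μ : Measure ℝ) (l : ℝ≥0∞) : Prop :=
  Tendsto (fun n : ℕ => optMax μ n / prophetMax μ n) atTop (𝓝 l)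

/-- `l` is the asymptotic competitive ratio of the i.i.d. min-prophet inequality. -/
def IsMinACR (μ : Measure ℝ) (l : ℝ≥0∞) : Prop :=
  Tendsto (fun n : ℕ => optMin μ n / prophetMin μ n) atTop (𝓝 l)

end ProphetMHR

/-! A monotone hazard rate makes `-log S` convex, where S is the survival function. Hence the
function Q = `quantile μ`, determined on `[0, ∞)` by S(Q(u)) = e^{-u}, is nonnegative, increasing
and concave there. If E is standard exponential, then Q(E) has law `μ` and Q(E/n) has the law of the
minimum of n draws, so the asymptotics reduce to properties of Q.

Maxima: Q(u)/u is non-increasing. With U = log n this bounds the prophet by Q(U)(1 + 1/U). The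
constant threshold Q(U - log U) fails with probability at most 1/n and is at least (1 - log U / U)
Q(U). So the ratio tends to 1 for every MHR law. The domain of attraction matters only for γ ≤ 0: a
positive γ would mean power-law tails, which log-concavity forbids.

Minima: attraction gives limits for the rescaled increments of Q near 0. Concavity then forces γ ≥
-1, and Q ≥ 0 turns the limits into regular variation, Q(s/n)/Q(1/n) → s^g with 0 ≤ g ≤ 1
(`ConcaveGrowth.exists_tendsto_ratio`). Dominated convergence gives E min ~ Γ(1+g) Q(1/n). The
optimal cost obeys c_{n+1} = E min(X, c_n). Heuristically, write c_n = Q(u_n): one step lowers Q(u)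
by about u Q(u) g/(1+g), while dQ ≈ g Q(u) du/u, so 1/u_n grows by about 1/(1+g). Thus c_n ~ (1+g)^g
Q(1/n) (`ConcaveGrowth.tendsto_recursion_div`); for g = 0 a crude upper bound on u_n suffices. The
limit (1+g)^g / Γ(1+g) is at most 2 by log-convexity of Γ. -/

namespace ProphetMHR

/-! ### Survival functions -/

/-- The survival function `1 - F`. -/
noncomputable def survival (μ : Measure ℝ) (x : ℝ) : ℝ := 1 - cdf μ x

/-- Survival functions of nonnegative continuous random variables whose cumulative hazard
`-log S` is convex. -/
structure IsLogConcaveSurvival (S : ℝ → ℝ) : Prop where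
  antitone : Antitone S
  continuous : Continuous S
  eq_one : ∀ x ≤ 0, S x = 1
  tendsto_zero : Tendsto S atTop (𝓝 0)
  -- Exponential lower bounds replace logarithms: the hypotheses force `S x` and `S y` to be
  -- positive, so no convention for log 0 enters.
  logConcave : ∀ x y u v a b : ℝ, 0 ≤ x → 0 ≤ y → 0 ≤ a → 0 ≤ b → a + b = 1 →
    Real.exp (-u) ≤ S x → Real.exp (-v) ≤ S y → Real.exp (-(a * u + b * v)) ≤ S (a * x + b * y)

section Survival

variable {μ : Measure ℝ}

theorem survival_antitone : Antitone (survival μ) := fun _ _ h =>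
  sub_le_sub_left (monotone_cdf μ h) 1

theorem survival_nonneg (x : ℝ) : 0 ≤ survival μ x := sub_nonneg.2 (cdf_le_one μ x)

theorem tendsto_survival_atTop : Tendsto (survival μ) atTop (𝓝 0) := by
  have h := (tendsto_cdf_atTop μ).const_sub 1
  rwa [sub_self] at h

theorem IsDensity.nullSingletonClass {f : ℝ → ℝ} (hf : IsDensity μ f) : NullSingletonClass μ := by
  refine ⟨fun x => ?_⟩
  rw [hf.eq_withDensity]
  exact withDensity_absolutelyContinuous _ _ (measure_singleton x)

variable [IsProbabilityMeasure μ]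

theorem ofReal_survival (x : ℝ) : ENNReal.ofReal (survival μ x) = μ (Set.Ioi x) := by
  rw [survival, cdf_eq_real, ← Set.compl_Iic, ← probReal_compl_eq_one_sub measurableSet_Iic,
    ofReal_measureReal]

theorem ofReal_survival_sub (s t : ℝ) :
    ENNReal.ofReal (survival μ s - survival μ t) = μ (Set.Ioc s t) := by
  conv_rhs => rw [← measure_cdf μ]
  rw [StieltjesFunction.measure_Ioc]
  congr 1
  simp only [survival]
  ring

theorem continuous_survival [NullSingletonClass μ] : Continuous (survival μ) := by
  have h : Continuous (cdf μ) := by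
    rw [continuous_iff_continuousAt]
    intro x
    have h0 := (cdf μ).measure_singleton x
    rw [measure_cdf, measure_singleton] at h0
    have h1 : cdf μ x - Function.leftLim (cdf μ) x ≤ 0 := ENNReal.ofReal_eq_zero.1 h0.symm
    have h2 : Function.leftLim (cdf μ) x = cdf μ x :=
      le_antisymm ((monotone_cdf μ).leftLim_le le_rfl) (by linarith)
    rw [(monotone_cdf μ).continuousAt_iff_leftLim_eq_rightLim, h2, (cdf μ).rightLim_eq]
  exact continuous_const.sub h

theorem IsDensity.ofReal_survival_sub {f : ℝ → ℝ} (hf : IsDensity μ f) (s t : ℝ) :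
    ENNReal.ofReal (survival μ s - survival μ t) =
      ∫⁻ x in Set.Ioc s t, ENNReal.ofReal (f x) := by
  rw [ProphetMHR.ofReal_survival_sub]
  conv_lhs => rw [hf.eq_withDensity]
  exact withDensity_apply _ measurableSet_Ioc

theorem IsDensity.survival_sub_le {f : ℝ → ℝ} (hf : IsDensity μ f) {s t k : ℝ} (hst : s ≤ t)
    (hk : ∀ x ∈ Set.Ioc s t, f x ≤ k) (hk0 : 0 ≤ k) :
    survival μ s - survival μ t ≤ k * (t - s) := by
  rw [← ENNReal.ofReal_le_ofReal_iff (mul_nonneg hk0 (by linarith)), hf.ofReal_survival_sub]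
  calc ∫⁻ x in Set.Ioc s t, ENNReal.ofReal (f x)
      ≤ ∫⁻ _ in Set.Ioc s t, ENNReal.ofReal k :=
        setLIntegral_mono measurable_const fun x hx => ENNReal.ofReal_le_ofReal (hk x hx)
    _ = ENNReal.ofReal (k * (t - s)) := by
        rw [setLIntegral_const, Real.volume_Ioc, ENNReal.ofReal_mul hk0]

theorem IsDensity.le_survival_sub {f : ℝ → ℝ} (hf : IsDensity μ f) {s t k : ℝ} (hst : s ≤ t)
    (hk : ∀ x ∈ Set.Ioc s t, k ≤ f x) (hk0 : 0 ≤ k) :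
    k * (t - s) ≤ survival μ s - survival μ t := by
  rw [← ENNReal.ofReal_le_ofReal_iff (sub_nonneg.2 (survival_antitone hst)),
    hf.ofReal_survival_sub]
  calc ENNReal.ofReal (k * (t - s)) = ∫⁻ _ in Set.Ioc s t, ENNReal.ofReal k := by
        rw [setLIntegral_const, Real.volume_Ioc, ENNReal.ofReal_mul hk0]
    _ ≤ _ := setLIntegral_mono hf.measurable.ennreal_ofReal
        fun x hx => ENNReal.ofReal_le_ofReal (hk x hx)

end Survival

/-! ### Monotone hazard rate implies log-concave survival -/

section Gronwall

/-- Discrete Grönwall inequality, from below. -/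
theorem mul_exp_neg_le_of_sub_le {S : ℝ → ℝ} {c x z : ℝ} (hxz : x ≤ z)
    (h : ∀ s t, x ≤ s → s ≤ t → t ≤ z → S s - S t ≤ c * S s * (t - s)) :
    S x * Real.exp (-(c * (z - x))) ≤ S z := by
  -- Euler polygon: n equal steps each cost a factor of at least 1 - c d, which is nonnegative once
  -- n exceeds c(z - x); then n → ∞.
  have hlim := (Real.tendsto_one_add_div_pow_exp (-(c * (z - x)))).const_mul (S x)
  refine le_of_tendsto hlim ?_
  obtain ⟨N, hN⟩ := exists_nat_gt (c * (z - x))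
  filter_upwards [eventually_ge_atTop (N + 1)] with n hn
  have hn0 : (0 : ℝ) < n := by exact_mod_cast (by omega : 0 < n)
  have hNn : (N : ℝ) ≤ n := by exact_mod_cast (by omega : N ≤ n)
  set d := (z - x) / n with hd
  have hd0 : 0 ≤ d := div_nonneg (by linarith) hn0.le
  have hnd : n * d = z - x := by rw [hd]; field_simp
  have hq : 1 + -(c * (z - x)) / n = 1 - c * d := by rw [hd]; ring
  rw [hq]
  have hpos : 0 ≤ 1 - c * d := by
    rw [← hq]
    have : c * (z - x) / n ≤ 1 := by rw [div_le_one hn0]; linarith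
    rw [neg_div]; linarith
  have key : ∀ k : ℕ, k ≤ n → S x * (1 - c * d) ^ k ≤ S (x + k * d) := by
    intro k
    induction k with
    | zero => intro _; simp
    | succ k ih =>
      intro hk
      have hkn : ((k + 1 : ℕ) : ℝ) ≤ n := by exact_mod_cast hk
      push_cast at hkn ⊢
      have h1 := ih (by omega)
      have h2 := h (x + k * d) (x + (k + 1) * d)
        (by have : 0 ≤ (k : ℝ) * d := by positivity
            linarith) (by nlinarith) (by nlinarith)
      calc S x * (1 - c * d) ^ (k + 1) = (S x * (1 - c * d) ^ k) * (1 - c * d) := by ring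
        _ ≤ S (x + k * d) * (1 - c * d) := mul_le_mul_of_nonneg_right h1 hpos
        _ ≤ S (x + (k + 1) * d) := by linarith
  have := key n le_rfl
  rwa [hnd, add_sub_cancel] at this

/-- Discrete Grönwall inequality, from above. -/
theorem mul_exp_le_of_le_sub {S : ℝ → ℝ} {c z y : ℝ} (hc : 0 ≤ c) (hzy : z ≤ y)
    (h : ∀ s t, z ≤ s → s ≤ t → t ≤ y → c * S t * (t - s) ≤ S s - S t) :
    S y * Real.exp (c * (y - z)) ≤ S z := by
  have hlim := (Real.tendsto_one_add_div_pow_exp (c * (y - z))).const_mul (S y)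
  refine le_of_tendsto hlim ?_
  filter_upwards [eventually_ge_atTop 1] with n hn
  have hn0 : (0 : ℝ) < n := by exact_mod_cast (by omega : 0 < n)
  set d := (y - z) / n with hd
  have hd0 : 0 ≤ d := div_nonneg (by linarith) hn0.le
  have hnd : n * d = y - z := by rw [hd]; field_simp
  have hq : 1 + c * (y - z) / n = 1 + c * d := by rw [hd]; ring
  rw [hq]
  have hpos : 0 ≤ 1 + c * d := by positivity
  have key : ∀ k : ℕ, k ≤ n → S y * (1 + c * d) ^ k ≤ S (y - k * d) := by
    intro k
    induction k with
    | zero => intro _; simp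
    | succ k ih =>
      intro hk
      have hkn : ((k + 1 : ℕ) : ℝ) ≤ n := by exact_mod_cast hk
      push_cast at hkn ⊢
      have h1 := ih (by omega)
      have h2 := h (y - (k + 1) * d) (y - k * d)
        (by nlinarith) (by nlinarith)
        (by have : 0 ≤ (k : ℝ) * d := by positivity
            linarith)
      calc S y * (1 + c * d) ^ (k + 1) = (S y * (1 + c * d) ^ k) * (1 + c * d) := by ring
        _ ≤ S (y - k * d) * (1 + c * d) := mul_le_mul_of_nonneg_right h1 hpos
        _ ≤ S (y - (k + 1) * d) := by linarith
  have := key n le_rfl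
  rwa [hnd, sub_sub_cancel] at this

end Gronwall

/-- The hazard rate c at the intermediate point z is a supporting slope: the rate is at most c
before z and at least c after it. The two Grönwall bounds compare log S(z) with the values at the
endpoints, and the terms in c cancel in the weighted average. No differentiability of S is needed.
-/
theorem IsMHR.isLogConcaveSurvival {μ : Measure ℝ} [IsProbabilityMeasure μ] (hμ : IsMHR μ) :
    IsLogConcaveSurvival (survival μ) := by
  obtain ⟨h0, f, hf, hmono⟩ := hμ
  have := hf.nullSingletonClass
  have hone : ∀ x ≤ 0, survival μ x = 1 := by
    intro x hx
    have : μ (Set.Iic x) = 0 := by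
      rw [← measure_congr (Iio_ae_eq_Iic (μ := μ) (a := x))]
      exact measure_mono_null (Set.Iio_subset_Iio hx) h0
    simp [survival, cdf_eq_real, measureReal_def, this]
  have hfeq : ∀ x, 0 < survival μ x → f x = hazardRate μ f x * survival μ x := fun x hx =>
    (div_mul_cancel₀ (f x) hx.ne').symm
  have hle : ∀ x y, 0 ≤ x → x ≤ y → 0 < survival μ y → hazardRate μ f x ≤ hazardRate μ f y := by
    intro x y hx hxy hy
    have hx' := hy.trans_le (survival_antitone hxy)
    exact hmono ⟨hx, by unfold survival at hx'; linarith⟩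
      ⟨hx.trans hxy, by unfold survival at hy; linarith⟩ hxy
  have hnn : ∀ x, 0 ≤ hazardRate μ f x := fun x => div_nonneg (hf.nonneg x) (survival_nonneg x)
  have main : ∀ x y u v a b : ℝ, 0 ≤ x → x ≤ y → 0 ≤ a → 0 ≤ b → a + b = 1 →
      Real.exp (-u) ≤ survival μ x → Real.exp (-v) ≤ survival μ y →
      Real.exp (-(a * u + b * v)) ≤ survival μ (a * x + b * y) := by
    intro x y u v a b hx hxy ha hb hab hu hv
    set z := a * x + b * y with hz
    have hxz : x ≤ z := by
      have : z - x = b * (y - x) := by rw [hz]; linear_combination x * hab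
      nlinarith
    have hzy : z ≤ y := by
      have : y - z = a * (y - x) := by rw [hz]; linear_combination (-y) * hab
      nlinarith
    have hSy : 0 < survival μ y := (Real.exp_pos _).trans_le hv
    have hSz : 0 < survival μ z := hSy.trans_le (survival_antitone hzy)
    set c := hazardRate μ f z with hc
    have h1 : survival μ x * Real.exp (-(c * (z - x))) ≤ survival μ z := by
      refine mul_exp_neg_le_of_sub_le hxz fun s t hs hst ht => ?_
      refine hf.survival_sub_le hst (fun w hw => ?_)
        (mul_nonneg (hnn z) (survival_nonneg s))
      have hwz : w ≤ z := hw.2.trans ht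
      rw [hfeq w (hSz.trans_le (survival_antitone hwz))]
      exact mul_le_mul (hle w z (hx.trans (hs.trans hw.1.le)) hwz hSz)
        (survival_antitone hw.1.le) (survival_nonneg w) (hnn z)
    have h2 : survival μ y * Real.exp (c * (y - z)) ≤ survival μ z := by
      refine mul_exp_le_of_le_sub (hnn z) hzy fun s t hs hst ht => ?_
      refine hf.le_survival_sub hst (fun w hw => ?_)
        (mul_nonneg (hnn z) (survival_nonneg t))
      have hSw : 0 < survival μ w := hSy.trans_le (survival_antitone (hw.2.trans ht))
      rw [hfeq w hSw]
      exact mul_le_mul (hle z w (hx.trans hxz) (hs.trans hw.1.le) hSw)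
        (survival_antitone hw.2) (survival_nonneg t) (hnn w)
    have h1' : -u - c * (z - x) ≤ Real.log (survival μ z) := by
      rw [Real.le_log_iff_exp_le hSz, sub_eq_add_neg, Real.exp_add]
      exact (mul_le_mul_of_nonneg_right hu (Real.exp_pos _).le).trans h1
    have h2' : -v + c * (y - z) ≤ Real.log (survival μ z) := by
      rw [Real.le_log_iff_exp_le hSz, Real.exp_add]
      exact (mul_le_mul_of_nonneg_right hv (Real.exp_pos _).le).trans h2
    rw [← Real.le_log_iff_exp_le hSz]
    have h3 := mul_le_mul_of_nonneg_left h1' ha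
    have h4 := mul_le_mul_of_nonneg_left h2' hb
    have h5 : a * Real.log (survival μ z) + b * Real.log (survival μ z) =
        Real.log (survival μ z) := by rw [← add_mul, hab, one_mul]
    have h6 : a * (z - x) - b * (y - z) = 0 := by
      rw [show a * (z - x) - b * (y - z) = (a + b) * z - (a * x + b * y) by ring, hab, ← hz]; ring
    have h7 : c * (a * (z - x) - b * (y - z)) = 0 := by rw [h6, mul_zero]
    nlinarith
  refine ⟨survival_antitone, continuous_survival, hone, tendsto_survival_atTop, ?_⟩
  intro x y u v a b hx hy ha hb hab hu hv
  rcases le_total x y with hxy | hxy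
  · exact main x y u v a b hx hxy ha hb hab hu hv
  · rw [add_comm (a * u), add_comm (a * x)]
    exact main y x v u b a hy hxy hb ha (by linarith) hv hu

/-! ### Quantiles in the exponential scale -/

/-- The generalized inverse of the cumulative hazard `-log S`. -/
noncomputable def hazardInv (S : ℝ → ℝ) (u : ℝ) : ℝ := sSup {x | Real.exp (-u) ≤ S x}

/-- Nonnegative concave increasing functions on `[0, ∞)` that are continuous at `0`. -/
structure ConcaveGrowth (Q : ℝ → ℝ) : Prop where
  nonneg : ∀ u, 0 ≤ u → 0 ≤ Q u
  strictMono : StrictMonoOn Q (Set.Ici 0)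
  concave : ConcaveOn ℝ (Set.Ici 0) Q
  tendsto_zero : Tendsto Q (𝓝[>] 0) (𝓝 (Q 0))
  measurable : Measurable Q

theorem ConcaveGrowth.measurable_div {Q : ℝ → ℝ} (hQ : ConcaveGrowth Q) (r : ℝ) :
    Measurable fun v => Q (v / r) :=
  hQ.measurable.comp (measurable_id.div_const r)

/-- The standard exponential distribution. -/
noncomputable def expLaw : Measure ℝ :=
  (volume.restrict (Set.Ioi 0)).withDensity fun v => ENNReal.ofReal (Real.exp (-v))

section HazardInv

variable {S : ℝ → ℝ} (hS : IsLogConcaveSurvival S)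
include hS

theorem IsLogConcaveSurvival.nonneg (x : ℝ) : 0 ≤ S x :=
  hS.antitone.le_of_tendsto hS.tendsto_zero x

theorem IsLogConcaveSurvival.le_one (x : ℝ) : S x ≤ 1 := by
  rcases le_total x 0 with h | h
  · exact (hS.eq_one x h).le
  · exact (hS.antitone h).trans (hS.eq_one 0 le_rfl).le

/-- The superlevel set is closed by continuity, bounded because S vanishes at infinity, and contains
0 because u ≥ 0. So its supremum is attained, which gives a Galois connection. -/
theorem IsLogConcaveSurvival.le_hazardInv_iff {u : ℝ} (hu : 0 ≤ u) (x : ℝ) :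
    x ≤ hazardInv S u ↔ Real.exp (-u) ≤ S x := by
  have hbdd : BddAbove {x | Real.exp (-u) ≤ S x} := by
    obtain ⟨y, hy⟩ := (hS.tendsto_zero.eventually (gt_mem_nhds (Real.exp_pos (-u)))).exists
    refine ⟨y, fun x hx => ?_⟩
    by_contra! h
    exact absurd (hx.trans (hS.antitone h.le)) (not_le.2 hy)
  have hne : {x | Real.exp (-u) ≤ S x}.Nonempty :=
    ⟨0, by
      simp only [Set.mem_ofPred_eq, hS.eq_one 0 le_rfl]
      exact Real.exp_le_one_iff.2 (by linarith)⟩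
  have hcl : IsClosed {x | Real.exp (-u) ≤ S x} := isClosed_le continuous_const hS.continuous
  constructor
  · intro h
    exact (hcl.csSup_mem hne hbdd).trans (hS.antitone h)
  · intro h
    exact le_csSup hbdd h

theorem IsLogConcaveSurvival.apply_hazardInv {u : ℝ} (hu : 0 ≤ u) :
    S (hazardInv S u) = Real.exp (-u) := by
  refine le_antisymm ?_ ((hS.le_hazardInv_iff hu _).1 le_rfl)
  refine le_of_tendsto (f := S) (x := 𝓝[>] (hazardInv S u))
    (hS.continuous.continuousAt.mono_left nhdsWithin_le_nhds) ?_
  filter_upwards [self_mem_nhdsWithin] with x hx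
  by_contra! h
  exact absurd ((hS.le_hazardInv_iff hu x).2 h.le) (not_le.2 hx)

theorem IsLogConcaveSurvival.concaveGrowth : ConcaveGrowth (hazardInv S) := by
  have hnn : ∀ u, 0 ≤ u → 0 ≤ hazardInv S u := fun u hu => by
    rw [hS.le_hazardInv_iff hu, hS.eq_one 0 le_rfl]
    exact Real.exp_le_one_iff.2 (by linarith)
  have hmono : StrictMonoOn (hazardInv S) (Set.Ici 0) := by
    intro u hu v hv huv
    by_contra! h
    have := hS.antitone h
    rw [hS.apply_hazardInv hu, hS.apply_hazardInv hv, Real.exp_le_exp] at this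
    linarith
  refine ⟨hnn, hmono, ⟨convex_Ici 0, ?_⟩, ?_, ?_⟩
  · intro u hu v hv a b ha hb hab
    simp only [smul_eq_mul]
    rw [hS.le_hazardInv_iff (by have := mul_nonneg ha hu; have := mul_nonneg hb hv; linarith)]
    exact hS.logConcave _ _ u v a b (hnn u hu) (hnn v hv) ha hb hab (hS.apply_hazardInv hu).ge
      (hS.apply_hazardInv hv).ge
  · rw [tendsto_order]
    constructor
    · intro y hy
      filter_upwards [self_mem_nhdsWithin] with u hu
      exact hy.trans (hmono Set.self_mem_Ici (Set.mem_Ici.2 (le_of_lt hu)) hu)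
    · intro y hy
      have hy1 : S y < 1 := by
        by_contra! h
        exact absurd ((hS.le_hazardInv_iff le_rfl y).2 (by simpa using h)) (not_le.2 hy)
      have hlim : Tendsto (fun u : ℝ => Real.exp (-u)) (𝓝[>] 0) (𝓝 1) := by
        have : Continuous fun u : ℝ => Real.exp (-u) := by fun_prop
        simpa using (this.tendsto 0).mono_left nhdsWithin_le_nhds
      filter_upwards [hlim.eventually (lt_mem_nhds hy1), self_mem_nhdsWithin] with u hu hu0
      by_contra! h
      exact absurd ((hS.le_hazardInv_iff (le_of_lt hu0) y).1 h) (not_le.2 hu)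
  -- For negative u the set is empty and `sSup ∅ = 0`, so the function is monotone on the whole line
  -- and therefore measurable.
  · have hneg : ∀ u < 0, hazardInv S u = 0 := by
      intro u hu
      have : {x | Real.exp (-u) ≤ S x} = ∅ := by
        ext x
        simp only [Set.mem_ofPred_eq, Set.mem_empty_iff_false, iff_false, not_le]
        exact (hS.le_one x).trans_lt (Real.one_lt_exp_iff.2 (by linarith))
      rw [hazardInv, this, Real.sSup_empty]
    refine Monotone.measurable fun u v huv => ?_
    rcases lt_or_ge u 0 with hu | hu
    · rw [hneg u hu]
      rcases lt_or_ge v 0 with hv | hv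
      · rw [hneg v hv]
      · exact hnn v hv
    · exact hmono.monotoneOn hu (hu.trans huv) huv

end HazardInv

theorem ae_expLaw_pos : ∀ᵐ v ∂expLaw, 0 < v :=
  (withDensity_absolutelyContinuous _ _).ae_le (ae_restrict_mem measurableSet_Ioi)

theorem lintegral_exp_neg_Ioi (a : ℝ) :
    ∫⁻ v in Set.Ioi a, ENNReal.ofReal (Real.exp (-v)) = ENNReal.ofReal (Real.exp (-a)) := by
  rw [← integral_exp_neg_Ioi a, ofReal_integral_eq_lintegral_ofReal
    (integrableOn_exp_neg_Ioi a) (ae_of_all _ fun _ => (Real.exp_pos _).le)]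

theorem expLaw_Ici {a : ℝ} (ha : 0 ≤ a) :
    expLaw (Set.Ici a) = ENNReal.ofReal (Real.exp (-a)) := by
  rw [expLaw, withDensity_apply _ measurableSet_Ici, Measure.restrict_restrict measurableSet_Ici,
    ← lintegral_exp_neg_Ioi a]
  refine setLIntegral_congr ?_
  have h1 : (Set.Ici a ∩ Set.Ioi 0 : Set ℝ) =ᵐ[volume] (Set.Ici a ∩ Set.Ici 0 : Set ℝ) :=
    (ae_eq_refl _).inter Ioi_ae_eq_Ici
  refine h1.trans ?_
  rw [Set.Ici_inter_Ici, sup_of_le_left ha]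
  exact Ioi_ae_eq_Ici.symm

instance : IsProbabilityMeasure expLaw := by
  refine ⟨?_⟩
  have h : (Set.univ : Set ℝ) =ᵐ[expLaw] Set.Ici 0 := by
    filter_upwards [ae_expLaw_pos] with v hv
    exact propext ⟨fun _ => le_of_lt hv, fun _ => trivial⟩
  rw [measure_congr h, expLaw_Ici le_rfl]
  simp

/-- S^n is the tail of the minimum of n draws, so a single exponential variable represents the
minima for all n at once. -/
theorem IsLogConcaveSurvival.map_expLaw_Ici {S : ℝ → ℝ} (hS : IsLogConcaveSurvival S) {n : ℕ}
    (hn : n ≠ 0) (x : ℝ) :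
    expLaw.map (fun v => hazardInv S (v / n)) (Set.Ici x) = ENNReal.ofReal (S x ^ n) := by
  have hn0 : (0 : ℝ) < n := by exact_mod_cast Nat.pos_of_ne_zero hn
  rw [Measure.map_apply (hS.concaveGrowth.measurable_div n) measurableSet_Ici]
  rcases (hS.nonneg x).eq_or_lt with h0 | h0
  -- The case S(x) = 0 is separate because `Real.log 0 = 0` would give the wrong cut-off.
  · rw [← h0, zero_pow hn, ENNReal.ofReal_zero]
    refine measure_mono_null (t := {v | ¬ 0 < v}) (fun v hv hv0 => ?_) ae_expLaw_pos
    have := (hS.le_hazardInv_iff (div_pos hv0 hn0).le x).1 hv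
    rw [← h0] at this
    exact absurd this (not_le.2 (Real.exp_pos _))
  · have ha : 0 ≤ -(n * Real.log (S x)) := by
      have := Real.log_nonpos h0.le (hS.le_one x)
      nlinarith
    have : ((fun v => hazardInv S (v / n)) ⁻¹' Set.Ici x) =ᵐ[expLaw]
        Set.Ici (-(n * Real.log (S x))) := by
      filter_upwards [ae_expLaw_pos] with v hv
      refine propext ?_
      change x ≤ hazardInv S (v / n) ↔ -(n * Real.log (S x)) ≤ v
      rw [hS.le_hazardInv_iff (div_pos hv hn0).le, ← Real.le_log_iff_exp_le h0, neg_le,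
        le_div_iff₀ hn0]
      constructor <;> intro h <;> linarith
    rw [measure_congr this, expLaw_Ici ha, neg_neg, Real.exp_nat_mul, Real.exp_log h0]

section Law

variable {μ : Measure ℝ} [IsProbabilityMeasure μ]

theorem IsMHR.measure_Ici (hμ : IsMHR μ) (x : ℝ) :
    μ (Set.Ici x) = ENNReal.ofReal (survival μ x) := by
  obtain ⟨_, f, hf, _⟩ := hμ
  have := hf.nullSingletonClass
  rw [ofReal_survival, measure_congr Ioi_ae_eq_Ici]

/-- The quantile function of a distribution, in the exponential scale. -/
noncomputable abbrev quantile (μ : Measure ℝ) : ℝ → ℝ := hazardInv (survival μ)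

theorem IsMHR.concaveGrowth (hμ : IsMHR μ) : ConcaveGrowth (quantile μ) :=
  hμ.isLogConcaveSurvival.concaveGrowth

theorem IsMHR.map_quantile (hμ : IsMHR μ) : expLaw.map (quantile μ) = μ := by
  symm
  refine Measure.ext_of_Ici _ _ fun x => ?_
  have := hμ.isLogConcaveSurvival.map_expLaw_Ici one_ne_zero x
  rw [hμ.measure_Ici]
  simpa using this.symm

theorem IsMHR.lintegral_eq (hμ : IsMHR μ) {φ : ℝ → ℝ≥0∞} (hφ : Measurable φ) :
    ∫⁻ x, φ x ∂μ = ∫⁻ v, φ (quantile μ v) ∂expLaw := by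
  conv_lhs => rw [← hμ.map_quantile]
  exact lintegral_map hφ hμ.concaveGrowth.measurable

theorem IsMHR.prophetMin_eq (hμ : IsMHR μ) {n : ℕ} (hn : n ≠ 0) :
    prophetMin μ n = ∫⁻ v, ENNReal.ofReal (quantile μ (v / n)) ∂expLaw := by
  have : NeZero n := ⟨hn⟩
  have hmeas : Measurable fun x : Fin n → ℝ => ⨅ i, x i :=
    Measurable.iInf fun i => measurable_pi_apply i
  have hlaw : (Measure.pi fun _ : Fin n => μ).map (fun x => ⨅ i, x i) =
      expLaw.map (fun v => quantile μ (v / n)) := by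
    have := Measure.isProbabilityMeasure_map (μ := Measure.pi fun _ : Fin n => μ) hmeas.aemeasurable
    refine Measure.ext_of_Ici _ _ fun y => ?_
    rw [hμ.isLogConcaveSurvival.map_expLaw_Ici hn, Measure.map_apply hmeas measurableSet_Ici]
    have : (fun x : Fin n → ℝ => ⨅ i, x i) ⁻¹' Set.Ici y = Set.univ.pi fun _ => Set.Ici y := by
      ext x
      simp only [Set.mem_preimage, Set.mem_Ici, Set.mem_pi, Set.mem_univ, true_imp_iff]
      exact le_ciInf_iff (Set.finite_range x).bddBelow
    rw [this, Measure.pi_pi, Finset.prod_const, Finset.card_univ, Fintype.card_fin,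
      hμ.measure_Ici, ENNReal.ofReal_pow (survival_nonneg y)]
  have hcomp : ∀ x : Fin n → ℝ, ⨅ i, ENNReal.ofReal (x i) = ENNReal.ofReal (⨅ i, x i) := fun x =>
    (Monotone.map_ciInf_of_continuousAt ENNReal.continuous_ofReal.continuousAt
      (fun _ _ h => ENNReal.ofReal_le_ofReal h) (Set.finite_range x).bddBelow).symm
  simp_rw [prophetMin, hcomp]
  rw [← lintegral_map (f := fun y => ENNReal.ofReal y) ENNReal.measurable_ofReal hmeas, hlaw,
    lintegral_map ENNReal.measurable_ofReal (hμ.concaveGrowth.measurable_div n)]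

end Law

/-! ### Policies, prophets and the dynamic programme -/

theorem measurable_minCost (n : ℕ) (t : Fin n → ℝ) : Measurable (minCost n t) := by
  induction n with
  | zero => exact measurable_const
  | succ n ih =>
    cases n with
    | zero => exact measurable_pi_apply 0
    | succ n =>
      refine Measurable.ite (measurableSet_le (measurable_pi_apply 0) measurable_const)
        (measurable_pi_apply 0) ((ih (Fin.tail t)).comp ?_)
      exact measurable_pi_lambda _ fun i => measurable_pi_apply _

theorem ofReal_maxReward_le (n : ℕ) (t x : Fin n → ℝ) :
    ENNReal.ofReal (maxReward n t x) ≤ ⨆ i, ENNReal.ofReal (x i) := by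
  induction n with
  | zero => simp [maxReward]
  | succ n ih =>
    rw [maxReward]
    split_ifs
    · exact le_iSup (fun i => ENNReal.ofReal (x i)) 0
    · exact (ih _ _).trans (iSup_le fun i => le_iSup (fun i => ENNReal.ofReal (x i)) i.succ)

theorem le_maxReward_const (n : ℕ) (τ : ℝ) (x : Fin n → ℝ) (h : ∃ i, τ ≤ x i) :
    τ ≤ maxReward n (fun _ => τ) x := by
  induction n with
  | zero => exact h.choose.elim0
  | succ n ih =>
    rw [maxReward]
    split_ifs with h0
    · exact h0
    · refine ih _ ?_
      obtain ⟨i, hi⟩ := h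
      cases i using Fin.cases with
      | zero => exact absurd hi h0
      | succ i => exact ⟨i, hi⟩

section

variable {μ : Measure ℝ}

theorem optMax_le_prophetMax (n : ℕ) : optMax μ n ≤ prophetMax μ n :=
  iSup_le fun t => lintegral_mono fun x => ofReal_maxReward_le n t x

theorem prophetMin_le_minCost (n : ℕ) (t x : Fin (n + 1) → ℝ) :
    ⨅ i, ENNReal.ofReal (x i) ≤ ENNReal.ofReal (minCost (n + 1) t x) := by
  induction n with
  | zero => exact iInf_le (fun i => ENNReal.ofReal (x i)) 0
  | succ n ih =>
    rw [minCost]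
    split_ifs
    · exact iInf_le (fun i => ENNReal.ofReal (x i)) 0
    · exact le_trans (le_iInf fun i => iInf_le (fun i => ENNReal.ofReal (x i)) (Fin.succ i)) (ih _ _)

theorem prophetMin_le_optMin (n : ℕ) : prophetMin μ (n + 1) ≤ optMin μ (n + 1) :=
  le_iInf fun t => lintegral_mono fun x => prophetMin_le_minCost n t x

variable [IsProbabilityMeasure μ]

/-- The constant threshold earns at least τ as soon as one draw reaches it. -/
theorem le_optMax (n : ℕ) (τ : ℝ) :
    ENNReal.ofReal τ * (1 - μ (Set.Iio τ) ^ n) ≤ optMax μ n := by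
  refine le_trans ?_ (le_iSup _ fun _ => τ)
  have hset : MeasurableSet (Set.univ.pi fun _ : Fin n => Set.Iio τ) :=
    MeasurableSet.univ_pi fun _ => measurableSet_Iio
  have hP : (Measure.pi fun _ : Fin n => μ) (Set.univ.pi fun _ => Set.Iio τ)ᶜ =
      1 - μ (Set.Iio τ) ^ n := by
    rw [prob_compl_eq_one_sub hset, Measure.pi_pi, Finset.prod_const, Finset.card_univ,
      Fintype.card_fin]
  rw [← hP, ← lintegral_indicator_const hset.compl]
  refine lintegral_mono fun x => ?_
  by_cases hx : x ∈ (Set.univ.pi fun _ : Fin n => Set.Iio τ)ᶜ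
  · rw [Set.indicator_of_mem hx]
    refine ENNReal.ofReal_le_ofReal (le_maxReward_const n τ x ?_)
    simpa [Set.mem_pi] using hx
  · rw [Set.indicator_of_notMem hx]
    exact zero_le

/-- Pointwise, the maximum is at most c plus the sum of the excesses over c. -/
theorem prophetMax_le (n : ℕ) (c : ℝ) :
    prophetMax μ n ≤ ENNReal.ofReal c + n * ∫⁻ x, ENNReal.ofReal (x - c) ∂μ := by
  have hpt : ∀ x : Fin n → ℝ, ⨆ i, ENNReal.ofReal (x i) ≤
      ENNReal.ofReal c + ∑ i, ENNReal.ofReal (x i - c) := by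
    intro x
    refine iSup_le fun i => ?_
    calc ENNReal.ofReal (x i) = ENNReal.ofReal (c + (x i - c)) := by ring_nf
      _ ≤ ENNReal.ofReal c + ENNReal.ofReal (x i - c) := ENNReal.ofReal_add_le
      _ ≤ _ := by
        gcongr
        exact Finset.single_le_sum (f := fun i => ENNReal.ofReal (x i - c))
          (fun _ _ => zero_le) (Finset.mem_univ i)
  have hm : Measurable fun y : ℝ => ENNReal.ofReal (y - c) := by fun_prop
  refine (lintegral_mono hpt).trans ?_
  rw [lintegral_add_left measurable_const, lintegral_const, measure_univ, mul_one,
    lintegral_finsetSum (f := fun i (x : Fin n → ℝ) => ENNReal.ofReal (x i - c)) _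
      fun i _ => hm.comp (measurable_pi_apply i)]
  gcongr
  refine le_of_eq ?_
  have : ∀ i : Fin n, ∫⁻ x : Fin n → ℝ, ENNReal.ofReal (x i - c) ∂(Measure.pi fun _ => μ) =
      ∫⁻ y, ENNReal.ofReal (y - c) ∂μ := fun i =>
    (measurePreserving_eval (fun _ : Fin n => μ) i).lintegral_comp hm
  simp [this]

theorem lintegral_pi_succ (n : ℕ) {φ : ℝ → (Fin n → ℝ) → ℝ≥0∞}
    (hφ : Measurable (Function.uncurry φ)) :
    ∫⁻ x : Fin (n + 1) → ℝ, φ (x 0) (Fin.tail x) ∂(Measure.pi fun _ => μ) =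
      ∫⁻ y, ∫⁻ z, φ y z ∂(Measure.pi fun _ => μ) ∂μ := by
  refine Eq.trans ?_ (lintegral_prod (Function.uncurry φ) hφ.aemeasurable)
  exact (measurePreserving_piFinSuccAbove (fun _ : Fin (n + 1) => μ) 0).lintegral_comp hφ

theorem optMin_one : optMin μ 1 = ∫⁻ x, ENNReal.ofReal x ∂μ := by
  have : ∀ t : Fin 1 → ℝ, ∫⁻ x, ENNReal.ofReal (minCost 1 t x) ∂(Measure.pi fun _ : Fin 1 => μ) =
      ∫⁻ x, ENNReal.ofReal x ∂μ := fun t =>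
    (measurePreserving_eval (fun _ : Fin 1 => μ) 0).lintegral_comp ENNReal.measurable_ofReal
  simp only [optMin, this, iInf_const]

theorem lintegral_minCost_succ (n : ℕ) (t : Fin (n + 2) → ℝ) :
    ∫⁻ x, ENNReal.ofReal (minCost (n + 2) t x) ∂(Measure.pi fun _ : Fin (n + 2) => μ) =
      ∫⁻ y, (if y ≤ t 0 then ENNReal.ofReal y else
        ∫⁻ z, ENNReal.ofReal (minCost (n + 1) (Fin.tail t) z)
          ∂(Measure.pi fun _ : Fin (n + 1) => μ)) ∂μ := by
  have hm : Measurable (Function.uncurry fun (y : ℝ) (z : Fin (n + 1) → ℝ) =>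
      ENNReal.ofReal (if y ≤ t 0 then y else minCost (n + 1) (Fin.tail t) z)) :=
    (Measurable.ite (measurableSet_le measurable_fst measurable_const) measurable_fst
      ((measurable_minCost _ _).comp measurable_snd)).ennreal_ofReal
  have h := lintegral_pi_succ (μ := μ) (n + 1) hm
  refine Eq.trans ?_ (h.trans ?_)
  · rfl
  · refine lintegral_congr fun y => ?_
    split_ifs
    · simp
    · rfl

theorem lintegral_min_add_le (c d : ℝ≥0∞) :
    ∫⁻ y, min (ENNReal.ofReal y) (c + d) ∂μ ≤ (∫⁻ y, min (ENNReal.ofReal y) c ∂μ) + d := by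
  calc ∫⁻ y, min (ENNReal.ofReal y) (c + d) ∂μ
      ≤ ∫⁻ y, (min (ENNReal.ofReal y) c + d) ∂μ := by
        refine lintegral_mono fun y => ?_
        rw [min_add]
        exact min_le_min le_self_add le_rfl
    _ = _ := by
        rw [lintegral_add_right _ measurable_const, lintegral_const, measure_univ, mul_one]

/-- Bellman equation: the best first threshold is the cost of continuing. Since the infimum over
later thresholds need not be attained, the upper bound uses a continuation that is optimal up to ε.
-/
theorem optMin_succ (n : ℕ) (hfin : optMin μ (n + 1) ≠ ∞) :
    optMin μ (n + 2) = ∫⁻ y, min (ENNReal.ofReal y) (optMin μ (n + 1)) ∂μ := by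
  refine le_antisymm ?_ (le_iInf fun t => ?_)
  · refine ENNReal.le_of_forall_pos_le_add fun ε hε _ => ?_
    obtain ⟨t, ht⟩ := iInf_lt_iff.1 (ENNReal.lt_add_right hfin (ENNReal.coe_pos.2 hε).ne')
    set C := ∫⁻ z, ENNReal.ofReal (minCost (n + 1) t z) ∂(Measure.pi fun _ : Fin (n + 1) => μ)
      with hC
    have hCtop : C ≠ ∞ := ht.ne_top
    calc optMin μ (n + 2) ≤ _ := iInf_le _ (Fin.cons C.toReal t)
      _ = ∫⁻ y, min (ENNReal.ofReal y) C ∂μ := by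
        rw [lintegral_minCost_succ]
        refine lintegral_congr fun y => ?_
        rw [Fin.cons_zero, Fin.tail_cons, ← hC]
        split_ifs with hy
        · rw [min_eq_left]
          rw [← ENNReal.ofReal_toReal hCtop]
          exact ENNReal.ofReal_le_ofReal hy
        · rw [min_eq_right]
          rw [← ENNReal.ofReal_toReal hCtop]
          exact ENNReal.ofReal_le_ofReal (not_le.1 hy).le
      _ ≤ ∫⁻ y, min (ENNReal.ofReal y) (optMin μ (n + 1) + ε) ∂μ :=
        lintegral_mono fun y => min_le_min le_rfl ht.le
      _ ≤ _ := lintegral_min_add_le _ _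
  · rw [lintegral_minCost_succ]
    refine lintegral_mono fun y => ?_
    dsimp only
    split_ifs
    · exact min_le_left _ _
    · exact (min_le_right _ _).trans (iInf_le _ _)

end

/-! ### Concavity bounds and the maximization problem -/

namespace ConcaveGrowth

variable {Q : ℝ → ℝ} (hQ : ConcaveGrowth Q)
include hQ

theorem mono {u v : ℝ} (hu : 0 ≤ u) (huv : u ≤ v) : Q u ≤ Q v :=
  hQ.strictMono.monotoneOn hu (hu.trans huv) huv

theorem pos {u : ℝ} (hu : 0 < u) : 0 < Q u :=
  (hQ.nonneg 0 le_rfl).trans_lt (hQ.strictMono Set.self_mem_Ici hu.le hu)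

/-- Q(u)/u is non-increasing, by concavity on the chord from 0 together with Q(0) ≥ 0. -/
theorem mul_le_mul {u v : ℝ} (hu : 0 ≤ u) (huv : u ≤ v) : u * Q v ≤ v * Q u := by
  rcases hu.eq_or_lt with rfl | hu
  · rw [zero_mul]; exact mul_nonneg huv (hQ.nonneg 0 le_rfl)
  have hv := hu.trans_le huv
  have h := hQ.concave.2 (Set.mem_Ici.2 hv.le) Set.self_mem_Ici
    (div_nonneg hu.le hv.le) (sub_nonneg.2 ((div_le_one hv).2 huv)) (add_sub_cancel _ _)
  simp only [smul_eq_mul, mul_zero, add_zero, div_mul_cancel₀ _ hv.ne'] at h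
  have h2 : 0 ≤ (1 - u / v) * Q 0 :=
    mul_nonneg (sub_nonneg.2 ((div_le_one hv).2 huv)) (hQ.nonneg 0 le_rfl)
  have h3 : u / v * Q v ≤ Q u := by linarith
  rw [div_mul_eq_mul_div, div_le_iff₀ hv] at h3
  linarith

end ConcaveGrowth

theorem lintegral_expLaw_sub {U : ℝ} (hU : 0 ≤ U) :
    ∫⁻ v, ENNReal.ofReal (v - U) ∂expLaw = ENNReal.ofReal (Real.exp (-U)) := by
  have h1 : ∀ v, ENNReal.ofReal (v - U) = ENNReal.ofReal (max (v - U) 0) := fun v => by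
    rw [ENNReal.ofReal_max, ENNReal.ofReal_zero, max_eq_left zero_le]
  simp_rw [h1]
  rw [lintegral_eq_lintegral_meas_le expLaw (f := fun v => max (v - U) 0)
    (ae_of_all _ fun v => le_max_right _ _) (by fun_prop)]
  calc ∫⁻ t in Set.Ioi 0, expLaw {v | t ≤ max (v - U) 0}
      = ∫⁻ t in Set.Ioi 0, ENNReal.ofReal (Real.exp (-U)) * ENNReal.ofReal (Real.exp (-t)) := by
        refine setLIntegral_congr_fun measurableSet_Ioi fun t ht => ?_
        have ht : 0 < t := ht
        have : {v | t ≤ max (v - U) 0} = Set.Ici (U + t) := by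
          ext v
          change t ≤ max (v - U) 0 ↔ U + t ≤ v
          rw [le_max_iff]
          constructor
          · rintro (h | h) <;> linarith
          · intro h; left; linarith
        rw [this, expLaw_Ici (by linarith), neg_add, Real.exp_add,
          ENNReal.ofReal_mul (Real.exp_pos _).le]
    _ = ENNReal.ofReal (Real.exp (-U)) := by
        rw [lintegral_const_mul _ (by fun_prop), lintegral_exp_neg_Ioi]
        simp

section

variable {μ : Measure ℝ} [IsProbabilityMeasure μ]

/-- Beyond U, Q stays below the ray through the origin and (U, Q(U)), so its excess is at most
(Q(U)/U)(v - U); and E (E - U)^+ = e^{-U}. -/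
theorem IsMHR.lintegral_sub_quantile_le (hμ : IsMHR μ) {U : ℝ} (hU : 0 < U) :
    ∫⁻ x, ENNReal.ofReal (x - quantile μ U) ∂μ ≤
      ENNReal.ofReal (quantile μ U * (Real.exp (-U) / U)) := by
  have hQ := hμ.concaveGrowth
  rw [hμ.lintegral_eq (by fun_prop)]
  calc ∫⁻ v, ENNReal.ofReal (quantile μ v - quantile μ U) ∂expLaw
      ≤ ∫⁻ v, ENNReal.ofReal (quantile μ U / U) * ENNReal.ofReal (v - U) ∂expLaw := by
        refine lintegral_mono_ae ?_
        filter_upwards [ae_expLaw_pos] with v hv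
        rcases le_total v U with h | h
        · rw [ENNReal.ofReal_of_nonpos (sub_nonpos.2 (hQ.mono hv.le h))]
          exact zero_le
        · rw [← ENNReal.ofReal_mul (div_nonneg (hQ.nonneg U hU.le) hU.le)]
          refine ENNReal.ofReal_le_ofReal ?_
          rw [div_mul_eq_mul_div, le_div_iff₀ hU]
          have := hQ.mul_le_mul hU.le h
          linarith
    _ = _ := by
        rw [lintegral_const_mul _ (by fun_prop), lintegral_expLaw_sub hU.le,
          ← ENNReal.ofReal_mul (div_nonneg (hQ.nonneg U hU.le) hU.le)]
        congr 1
        ring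

theorem IsMHR.prophetMax_le (hμ : IsMHR μ) {n : ℕ} (hn : 2 ≤ n) :
    prophetMax μ n ≤ ENNReal.ofReal (quantile μ (Real.log n) * (1 + 1 / Real.log n)) := by
  have hQ := hμ.concaveGrowth
  have hn1 : (1 : ℝ) < n := by exact_mod_cast (by omega : 1 < n)
  have hU : 0 < Real.log n := Real.log_pos hn1
  refine (ProphetMHR.prophetMax_le n (quantile μ (Real.log n))).trans ?_
  have h := hμ.lintegral_sub_quantile_le hU
  calc _ ≤ ENNReal.ofReal (quantile μ (Real.log n)) +
        n * ENNReal.ofReal (quantile μ (Real.log n) * (Real.exp (-Real.log n) / Real.log n)) := by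
        gcongr
    _ = _ := by
        have hq := hQ.nonneg _ hU.le
        rw [← ENNReal.ofReal_natCast n, ← ENNReal.ofReal_mul (by positivity),
          ← ENNReal.ofReal_add hq (by positivity)]
        congr 1
        rw [Real.exp_neg, Real.exp_log (by linarith)]
        field_simp

theorem IsMHR.le_optMax (hμ : IsMHR μ) {n : ℕ} {w : ℝ} (hw : 0 ≤ w) :
    ENNReal.ofReal (quantile μ w * (1 - Real.exp (-(n * Real.exp (-w))))) ≤ optMax μ n := by
  have hQ := hμ.concaveGrowth
  refine le_trans ?_ (ProphetMHR.le_optMax n (quantile μ w))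
  rw [ENNReal.ofReal_mul (hQ.nonneg w hw)]
  gcongr
  have h1 : μ (Set.Iio (quantile μ w)) = ENNReal.ofReal (1 - Real.exp (-w)) := by
    rw [← Set.compl_Ici, prob_compl_eq_one_sub measurableSet_Ici, hμ.measure_Ici,
      hμ.isLogConcaveSurvival.apply_hazardInv hw, ENNReal.ofReal_sub _ (Real.exp_pos _).le,
      ENNReal.ofReal_one]
  have hp : 0 ≤ 1 - Real.exp (-w) := sub_nonneg.2 (Real.exp_le_one_iff.2 (by linarith))
  rw [h1, ENNReal.ofReal_sub _ (Real.exp_pos _).le, ENNReal.ofReal_one]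
  gcongr
  rw [← ENNReal.ofReal_pow hp]
  refine ENNReal.ofReal_le_ofReal ?_
  calc (1 - Real.exp (-w)) ^ n ≤ Real.exp (-Real.exp (-w)) ^ n :=
        pow_le_pow_left₀ hp (Real.one_sub_le_exp_neg _) n
    _ = _ := by rw [← Real.exp_nat_mul]; ring_nf

theorem tendsto_log_natCast_atTop : Tendsto (fun n : ℕ => Real.log n) atTop atTop :=
  Real.tendsto_log_atTop.comp tendsto_natCast_atTop_atTop

/-- The threshold is Q(w) with w = U - log U and U = log n. The shift makes the expected number of
acceptable draws equal to U, so failure has probability at most e^{-U} = 1/n, yet it is o(U) and by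
concavity costs only a factor tending to 1. -/
theorem IsMHR.isMaxACR_one (hμ : IsMHR μ) : IsMaxACR μ 1 := by
  have hQ := hμ.concaveGrowth
  have hlim : Tendsto (fun n : ℕ => ENNReal.ofReal
      ((1 - Real.log (Real.log n) / Real.log n) * (1 - (n : ℝ)⁻¹) / (1 + 1 / Real.log n)))
      atTop (𝓝 1) := by
    have h1 : Tendsto (fun n : ℕ => Real.log (Real.log n) / Real.log n) atTop (𝓝 0) :=
      Real.isLittleO_log_id_atTop.tendsto_div_nhds_zero.comp tendsto_log_natCast_atTop
    have h2 : Tendsto (fun n : ℕ => (n : ℝ)⁻¹) atTop (𝓝 0) :=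
      tendsto_inv_atTop_zero.comp tendsto_natCast_atTop_atTop
    have h3 : Tendsto (fun n : ℕ => 1 / Real.log n) atTop (𝓝 0) := by
      simpa [Function.comp_def] using tendsto_inv_atTop_zero.comp tendsto_log_natCast_atTop
    have h := ((h1.const_sub 1).mul (h2.const_sub 1)).div (h3.const_add 1) (by norm_num)
    simpa using ENNReal.tendsto_ofReal h
  refine tendsto_of_tendsto_of_tendsto_of_le_of_le' hlim tendsto_const_nhds ?_
    (Eventually.of_forall fun n => ENNReal.div_le_of_le_mul (by
      rw [one_mul]; exact optMax_le_prophetMax n))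
  filter_upwards [eventually_ge_atTop 2,
    tendsto_log_natCast_atTop.eventually_ge_atTop 1] with n hn hlog
  set U := Real.log n with hU
  have hn0 : (0 : ℝ) < n := by exact_mod_cast (by omega : 0 < n)
  have hU0 : 0 < U := by linarith
  have hw0 : 0 ≤ U - Real.log U := by
    have := Real.log_le_sub_one_of_pos hU0
    linarith
  have hexp : n * Real.exp (-(U - Real.log U)) = U := by
    rw [neg_sub, Real.exp_sub, Real.exp_log hU0, hU, Real.exp_log hn0]
    field_simp
  have hlow := hμ.le_optMax (n := n) hw0
  rw [hexp, Real.exp_neg, hU, Real.exp_log hn0, ← hU] at hlow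
  have hup := hμ.prophetMax_le hn
  rw [← hU] at hup
  have hn1 : 0 ≤ 1 - (n : ℝ)⁻¹ := by
    rw [sub_nonneg]; exact inv_le_one_of_one_le₀ (by exact_mod_cast (by omega : 1 ≤ n))
  have hqU : 0 < quantile μ U := hQ.pos hU0
  have hden : 0 < quantile μ U * (1 + 1 / U) := by positivity
  calc ENNReal.ofReal ((1 - Real.log U / U) * (1 - (n : ℝ)⁻¹) / (1 + 1 / U))
      ≤ ENNReal.ofReal (quantile μ (U - Real.log U) * (1 - (n : ℝ)⁻¹) /
          (quantile μ U * (1 + 1 / U))) := by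
        refine ENNReal.ofReal_le_ofReal ?_
        rw [div_le_div_iff₀ (by positivity) hden]
        have hlogU : 0 ≤ Real.log U := Real.log_nonneg hlog
        have h := hQ.mul_le_mul hw0 (by linarith : U - Real.log U ≤ U)
        have h' : (1 - Real.log U / U) * quantile μ U ≤ quantile μ (U - Real.log U) := by
          rw [← mul_le_mul_iff_right₀ hU0]
          calc U * ((1 - Real.log U / U) * quantile μ U) = (U - Real.log U) * quantile μ U := by
                field_simp
            _ ≤ _ := h
        have hk : 0 ≤ (1 - (n : ℝ)⁻¹) * (1 + 1 / U) := by positivity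
        nlinarith [mul_le_mul_of_nonneg_right h' hk]
    _ = ENNReal.ofReal (quantile μ (U - Real.log U) * (1 - (n : ℝ)⁻¹)) /
          ENNReal.ofReal (quantile μ U * (1 + 1 / U)) := ENNReal.ofReal_div_of_pos hden
    _ ≤ _ := ENNReal.div_le_div hlow hup

end

/-! ### The sign of the index for maxima -/

/-- If `p n ^ n` has a positive limit, then `n * (1 - p n)` converges. -/
theorem tendsto_nat_mul_one_sub {p : ℕ → ℝ} {L : ℝ} (hL : 0 < L) (hp : ∀ n, 0 ≤ p n)
    (h : Tendsto (fun n => p n ^ n) atTop (𝓝 L)) :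
    Tendsto (fun n => n * (1 - p n)) atTop (𝓝 (-Real.log L)) := by
  have h1 : Tendsto (fun n : ℕ => n * Real.log (p n)) atTop (𝓝 (Real.log L)) := by
    simpa [Real.log_pow] using (h.log hL.ne')
  have hpos : ∀ᶠ n in atTop, 0 < p n := by
    filter_upwards [h.eventually (lt_mem_nhds hL), eventually_ge_atTop 1] with n hn hn1
    refine (hp n).lt_of_ne fun h0 => ?_
    rw [← h0, zero_pow (by omega)] at hn
    exact lt_irrefl _ hn
  have hlog : Tendsto (fun n => Real.log (p n)) atTop (𝓝 0) := by
    have h2 := h1.mul (tendsto_inv_atTop_zero.comp (tendsto_natCast_atTop_atTop (R := ℝ)))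
    rw [mul_zero] at h2
    refine h2.congr' ?_
    filter_upwards [eventually_ge_atTop 1] with n hn
    have : (n : ℝ) ≠ 0 := by exact_mod_cast (by omega : n ≠ 0)
    simp only [Function.comp]
    field_simp
  have hp1 : Tendsto p atTop (𝓝 1) := by
    have h2 := (Real.continuous_exp.tendsto 0).comp hlog
    rw [Real.exp_zero] at h2
    refine h2.congr' ?_
    filter_upwards [hpos] with n hn
    exact Real.exp_log hn
  -- Squeeze from -p log p ≤ 1 - p ≤ -log p.
  have hlow : Tendsto (fun n : ℕ => p n * -(n * Real.log (p n))) atTop (𝓝 (-Real.log L)) := by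
    simpa using hp1.mul h1.neg
  refine tendsto_of_tendsto_of_tendsto_of_le_of_le' hlow h1.neg ?_ ?_
  · filter_upwards [hpos] with n hn
    have h3 := Real.one_sub_inv_le_log_of_pos hn
    have h4 : p n - 1 ≤ p n * Real.log (p n) := by
      have := mul_le_mul_of_nonneg_left h3 hn.le
      rwa [mul_sub, mul_one, mul_inv_cancel₀ hn.ne'] at this
    have hn0 : (0 : ℝ) ≤ n := n.cast_nonneg
    nlinarith
  · filter_upwards [hpos] with n hn
    have h3 := Real.log_le_sub_one_of_pos hn
    have hn0 : (0 : ℝ) ≤ n := n.cast_nonneg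
    nlinarith

theorem IsLogConcaveSurvival.midpoint {S : ℝ → ℝ} (hS : IsLogConcaveSurvival S) {x y : ℝ}
    (hx : 0 ≤ x) (hy : 0 ≤ y) : S x * S y ≤ S ((x + y) / 2) ^ 2 := by
  rcases (hS.nonneg x).eq_or_lt with h | hx0
  · rw [← h, zero_mul]; positivity
  rcases (hS.nonneg y).eq_or_lt with h | hy0
  · rw [← h, mul_zero]; positivity
  have := hS.logConcave x y (-Real.log (S x)) (-Real.log (S y)) (1 / 2) (1 / 2) hx hy
    (by norm_num) (by norm_num) (by norm_num) (by rw [neg_neg, Real.exp_log hx0])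
    (by rw [neg_neg, Real.exp_log hy0])
  rw [show 1 / 2 * x + 1 / 2 * y = (x + y) / 2 by ring] at this
  refine le_trans (le_of_eq ?_) (pow_le_pow_left₀ (Real.exp_pos _).le this 2)
  rw [← Real.exp_nat_mul]
  conv_lhs => rw [← Real.exp_log hx0, ← Real.exp_log hy0, ← Real.exp_add]
  congr 1
  push_cast
  ring

/-- Log-concavity at the three equally spaced points where 1 + γx equals 1, 2, 3 passes to the limit
as 3^(-1/γ) ≤ 4^(-1/γ), which is false for γ > 0. -/
theorem IsMHR.nonpos_of_inMaxDomain {μ : Measure ℝ} [IsProbabilityMeasure μ] (hμ : IsMHR μ)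
    {γ : ℝ} (h : InMaxDomain μ γ) : γ ≤ 0 := by
  by_contra! hγ
  obtain ⟨a, b, ha, hlim⟩ := h
  have hS := hμ.isLogConcaveSurvival
  have key : ∀ m : ℝ, 1 ≤ m →
      Tendsto (fun n : ℕ => n * survival μ (a n * ((m - 1) / γ) + b n)) atTop
        (𝓝 (m ^ (-1 / γ))) ∧ ∀ᶠ n in atTop, 0 ≤ a n * ((m - 1) / γ) + b n := by
    intro m hm
    have hm' : 1 + γ * ((m - 1) / γ) = m := by field_simp; ring
    have h1 := hlim ((m - 1) / γ) (by rw [hm']; linarith)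
    rw [evMax, if_neg hγ.ne', hm'] at h1
    have h2 := tendsto_nat_mul_one_sub (Real.exp_pos _) (fun n => cdf_nonneg μ _) h1
    rw [Real.log_exp, neg_neg] at h2
    refine ⟨h2, ?_⟩
    have hlt : Real.exp (-m ^ (-1 / γ)) < 1 := by
      rw [Real.exp_lt_one_iff]
      exact neg_neg_of_pos (Real.rpow_pos_of_pos (by linarith) _)
    have hpos : 0 < m ^ (-1 / γ) := Real.rpow_pos_of_pos (by linarith) _
    -- Survival tends to 0 along these points, whereas it is 1 to the left of 0; so the points are
    -- eventually nonnegative, as log-concavity requires.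
    have hS1 : Tendsto (fun n : ℕ => survival μ (a n * ((m - 1) / γ) + b n)) atTop (𝓝 0) := by
      have h3 := h2.mul (tendsto_inv_atTop_zero.comp (tendsto_natCast_atTop_atTop (R := ℝ)))
      rw [mul_zero] at h3
      refine h3.congr' ?_
      filter_upwards [eventually_ge_atTop 1] with n hn
      have : (n : ℝ) ≠ 0 := by exact_mod_cast (by omega : n ≠ 0)
      simp only [Function.comp, survival]
      field_simp
    filter_upwards [hS1.eventually (gt_mem_nhds one_pos)] with n hn
    by_contra! hneg
    rw [hS.eq_one _ hneg.le] at hn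
    exact lt_irrefl _ hn
  obtain ⟨h1, e1⟩ := key 1 le_rfl
  obtain ⟨h2, -⟩ := key 2 (by norm_num)
  obtain ⟨h3, e3⟩ := key 3 (by norm_num)
  have hle := le_of_tendsto_of_tendsto (h1.mul h3) (h2.pow 2) (by
    filter_upwards [e1, e3] with n hn1 hn3
    have := hS.midpoint hn1 hn3
    rw [show (a n * ((1 - 1) / γ) + b n + (a n * ((3 - 1) / γ) + b n)) / 2 =
      a n * ((2 - 1) / γ) + b n by ring] at this
    have hn0 : (0 : ℝ) ≤ (n : ℝ) ^ 2 := by positivity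
    nlinarith [mul_le_mul_of_nonneg_left this hn0])
  rw [Real.one_rpow, one_mul, ← Real.rpow_natCast, ← Real.rpow_mul (by norm_num),
    mul_comm, Real.rpow_mul (by norm_num), Real.rpow_le_rpow_iff_of_neg (by norm_num) (by norm_num)
      (div_neg_of_neg_of_pos (by norm_num) hγ)] at hle
  norm_num at hle

/-! ### Extreme value limits for minima and regular variation of quantiles -/

/-- The inverse of `x ↦ (1 - γ * x) ^ (-1 / γ)`, read as `log` for `γ = 0`. -/
noncomputable def evQuantile (γ s : ℝ) : ℝ :=
  if γ = 0 then Real.log s else (1 - s ^ (-γ)) / γ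

theorem one_sub_mul_evQuantile_pos (γ : ℝ) {s : ℝ} (hs : 0 < s) :
    0 < 1 - γ * evQuantile γ s := by
  rcases eq_or_ne γ 0 with rfl | h
  · simp
  · rw [evQuantile, if_neg h, mul_div_cancel₀ _ h, sub_sub_cancel]
    exact Real.rpow_pos_of_pos hs _

theorem evMin_evQuantile (γ : ℝ) {s : ℝ} (hs : 0 < s) :
    evMin γ (evQuantile γ s) = Real.exp (-s) := by
  rcases eq_or_ne γ 0 with rfl | h
  · simp [evMin, evQuantile, Real.exp_log hs]
  · rw [evMin, evQuantile, if_neg h, if_neg h, mul_div_cancel₀ _ h, sub_sub_cancel,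
      ← Real.rpow_mul hs.le, show -γ * (-1 / γ) = 1 by field_simp, Real.rpow_one]

theorem continuousAt_evQuantile (γ : ℝ) {s : ℝ} (hs : 0 < s) :
    ContinuousAt (evQuantile γ) s := by
  rcases eq_or_ne γ 0 with rfl | h
  · have : evQuantile 0 = Real.log := by ext s; simp [evQuantile]
    rw [this]
    exact Real.continuousAt_log hs.ne'
  · have : evQuantile γ = fun s => (1 - s ^ (-γ)) / γ := by ext s; simp [evQuantile, h]
    rw [this]
    exact (continuousAt_const.sub (Real.continuousAt_rpow_const s _ (Or.inl hs.ne'))).div_const _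

theorem evQuantile_one (γ : ℝ) : evQuantile γ 1 = 0 := by
  simp [evQuantile]

/-- Convergence of the survival functions implies convergence of the quantiles. -/
theorem IsLogConcaveSurvival.tendsto_hazardInv {S : ℝ → ℝ} (hS : IsLogConcaveSurvival S) {γ : ℝ}
    {a b : ℕ → ℝ} (ha : ∀ n, 0 < a n)
    (hlim : ∀ x, 0 < 1 - γ * x → Tendsto (fun n => S (a n * x + b n) ^ n) atTop (𝓝 (evMin γ x)))
    {s : ℝ} (hs : 0 < s) :
    Tendsto (fun n : ℕ => (hazardInv S (s / n) - b n) / a n) atTop (𝓝 (evQuantile γ s)) := by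
  have hlim' : ∀ r, 0 < r →
      Tendsto (fun n => S (a n * evQuantile γ r + b n) ^ n) atTop (𝓝 (Real.exp (-r))) := by
    intro r hr
    have := hlim _ (one_sub_mul_evQuantile_pos γ hr)
    rwa [evMin_evQuantile γ hr] at this
  have hpow : ∀ n : ℕ, 1 ≤ n → Real.exp (-s) = Real.exp (-(s / n)) ^ n := by
    intro n hn
    have : (n : ℝ) ≠ 0 := by exact_mod_cast (by omega : n ≠ 0)
    rw [← Real.exp_nat_mul]
    congr 1
    field_simp
  rw [tendsto_order]
  constructor
  · intro y hy
    -- Room on both sides: the limit e^{-r} is strictly above e^{-s}, so eventually the point for r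
    -- has survival above e^{-s/n} and lies below the quantile at s/n.
    obtain ⟨r, hyr, hr0, hrs⟩ : ∃ r, y < evQuantile γ r ∧ 0 < r ∧ r < s := by
      have h1 : ∀ᶠ r in 𝓝[<] s, y < evQuantile γ r :=
        ((continuousAt_evQuantile γ hs).eventually (lt_mem_nhds hy)).filter_mono nhdsWithin_le_nhds
      have h2 : ∀ᶠ r in 𝓝[<] s, 0 < r :=
        (lt_mem_nhds hs).filter_mono nhdsWithin_le_nhds
      exact (h1.and (h2.and self_mem_nhdsWithin)).exists
    have hlt : Real.exp (-s) < Real.exp (-r) := Real.exp_lt_exp.2 (by linarith)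
    filter_upwards [(hlim' r hr0).eventually (lt_mem_nhds hlt), eventually_ge_atTop 1] with n hn hn1
    refine hyr.trans_le ?_
    rw [le_div_iff₀ (ha n), le_sub_iff_add_le, mul_comm,
      hS.le_hazardInv_iff (by positivity)]
    rw [hpow n hn1] at hn
    exact (lt_of_pow_lt_pow_left₀ n (hS.nonneg _) hn).le
  · intro y hy
    obtain ⟨r, hyr, hrs⟩ : ∃ r, evQuantile γ r < y ∧ s < r := by
      have h1 : ∀ᶠ r in 𝓝[>] s, evQuantile γ r < y :=
        ((continuousAt_evQuantile γ hs).eventually (gt_mem_nhds hy)).filter_mono nhdsWithin_le_nhds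
      exact (h1.and self_mem_nhdsWithin).exists
    have hlt : Real.exp (-r) < Real.exp (-s) := Real.exp_lt_exp.2 (by linarith)
    filter_upwards [(hlim' r (hs.trans hrs)).eventually (gt_mem_nhds hlt),
      eventually_ge_atTop 1] with n hn hn1
    refine lt_of_le_of_lt ?_ hyr
    rw [div_le_iff₀ (ha n), sub_le_iff_le_add, mul_comm]
    by_contra! h
    have h2 := (hS.le_hazardInv_iff (by positivity : 0 ≤ s / n) _).1 h.le
    rw [hpow n hn1] at hn
    exact absurd (pow_le_pow_left₀ (Real.exp_pos _).le h2 n) (not_le.2 hn)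

/-- The increments of `Q` near zero, in suitable units, converge to those of the quantile
function of an extreme value distribution for minima. -/
def IncrementsConverge (Q : ℝ → ℝ) (γ : ℝ) (a : ℕ → ℝ) : Prop :=
  ∀ s t, 0 < s → 0 < t → Tendsto (fun n : ℕ => (Q (s / n) - Q (t / n)) / a n) atTop
    (𝓝 (evQuantile γ s - evQuantile γ t))

/-- Differences eliminate the centring b_n; only the scale a_n survives. -/
theorem IsMHR.incrementsConverge {μ : Measure ℝ} [IsProbabilityMeasure μ] (hμ : IsMHR μ)
    {γ : ℝ} (h : InMinDomain μ γ) :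
    ∃ a : ℕ → ℝ, (∀ n, 0 < a n) ∧ IncrementsConverge (quantile μ) γ a := by
  obtain ⟨a, b, ha, hlim⟩ := h
  refine ⟨a, ha, fun s t hs ht => ?_⟩
  have h1 := (hμ.isLogConcaveSurvival.tendsto_hazardInv ha hlim hs).sub
    (hμ.isLogConcaveSurvival.tendsto_hazardInv ha hlim ht)
  refine h1.congr fun n => ?_
  ring

theorem tendsto_div_nat_nhdsGT {s : ℝ} (hs : 0 < s) :
    Tendsto (fun n : ℕ => s / n) atTop (𝓝[>] 0) := by
  refine tendsto_nhdsWithin_iff.2 ⟨tendsto_const_div_atTop_nhds_zero_nat s, ?_⟩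
  filter_upwards [eventually_ge_atTop 1] with n hn
  have : (0 : ℝ) < n := by exact_mod_cast (by omega : 0 < n)
  exact div_pos hs this

section

variable {Q : ℝ → ℝ} (hQ : ConcaveGrowth Q) {γ : ℝ} {a : ℕ → ℝ} (ha : ∀ n, 0 < a n)
  (hinc : IncrementsConverge Q γ a)
include hQ ha hinc

/-- Concavity at 1/n, 2/n, 3/n survives in the limit, but for γ < -1 the limiting quantile function
is strictly convex. -/
theorem ConcaveGrowth.neg_one_le : -1 ≤ γ := by
  by_contra! hγ
  have hle := le_of_tendsto_of_tendsto (hinc 3 2 (by norm_num) (by norm_num))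
    (hinc 2 1 (by norm_num) (by norm_num)) (Eventually.of_forall fun n => by
      refine div_le_div_of_nonneg_right ?_ (ha n).le
      have h := hQ.concave.2 (x := 1 / n) (y := 3 / n) (Set.mem_Ici.2 (by positivity))
        (Set.mem_Ici.2 (by positivity)) (by norm_num : (0 : ℝ) ≤ 1 / 2)
        (by norm_num : (0 : ℝ) ≤ 1 / 2) (by norm_num)
      simp only [smul_eq_mul] at h
      rw [show 1 / 2 * (1 / (n : ℝ)) + 1 / 2 * (3 / n) = 2 / n by ring] at h
      linarith)
  have hγ0 : γ ≠ 0 := by linarith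
  have hconv := (strictConvexOn_rpow (by linarith : 1 < -γ)).2 (x := 1) (y := 3)
    (by norm_num) (by norm_num) (by norm_num) (by norm_num : (0 : ℝ) < 1 / 2)
    (by norm_num : (0 : ℝ) < 1 / 2) (by norm_num)
  simp only [smul_eq_mul] at hconv
  rw [show (1 / 2 * 1 + 1 / 2 * 3 : ℝ) = 2 by norm_num] at hconv
  simp only [evQuantile, if_neg hγ0] at hle
  rw [← sub_div, ← sub_div, div_le_div_right_of_neg (by linarith)] at hle
  linarith

/-- For γ ≥ 0 the limiting quantile is unbounded below near 0. As Q ≥ 0, this forces Q(1/n)/a_n → ∞,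
so increments of order a_n are negligible. -/
theorem ConcaveGrowth.tendsto_ratio_of_nonneg (hγ : 0 ≤ γ) {s : ℝ} (hs : 0 < s) :
    Tendsto (fun n : ℕ => Q (s / n) / Q (1 / n)) atTop (𝓝 1) := by
  have hbig : Tendsto (fun n : ℕ => Q (1 / n) / a n) atTop atTop := by
    rw [tendsto_atTop]
    intro M
    have hR : evQuantile γ (Real.exp (-(M + 1))) ≤ -(M + 1) := by
      rcases hγ.eq_or_lt with rfl | hγ
      · simp [evQuantile]
      · rw [evQuantile, if_neg hγ.ne', div_le_iff₀ hγ, ← Real.exp_mul]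
        have := Real.add_one_le_exp (-(M + 1) * -γ)
        linarith
    have hlim := hinc 1 (Real.exp (-(M + 1))) one_pos (Real.exp_pos _)
    rw [evQuantile_one] at hlim
    filter_upwards [hlim.eventually (lt_mem_nhds (by linarith : M < 0 - _))] with n hn
    refine hn.le.trans (div_le_div_of_nonneg_right ?_ (ha n).le)
    linarith [hQ.nonneg (Real.exp (-(M + 1)) / n) (by positivity)]
  have h := ((hinc s 1 hs one_pos).mul (tendsto_inv_atTop_zero.comp hbig)).const_add 1
  rw [mul_zero, add_zero] at h
  refine h.congr' ?_
  filter_upwards [eventually_ge_atTop 1] with n hn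
  have hn0 : (0 : ℝ) < n := by exact_mod_cast (by omega : 0 < n)
  have hq := hQ.pos (div_pos one_pos hn0)
  have han := ha n
  simp only [Function.comp]
  field_simp
  ring

omit ha hinc in
theorem ConcaveGrowth.tendsto_ratio_of_pos (h0 : 0 < Q 0) {s : ℝ} (hs : 0 < s) :
    Tendsto (fun n : ℕ => Q (s / n) / Q (1 / n)) atTop (𝓝 1) := by
  have h := (hQ.tendsto_zero.comp (tendsto_div_nat_nhdsGT hs)).div
    (hQ.tendsto_zero.comp (tendsto_div_nat_nhdsGT one_pos)) h0.ne'
  rwa [div_self h0.ne'] at h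

/-- Since Q(0) = 0, Q(1/n) is the sum of its dyadic increments, whose successive ratios approach q =
2^(-g) with g = -γ. It is thus asymptotic to the first increment over 1 - q. The lower bound only
needs Q(s/n) ≥ 0 and s → 0. -/
theorem ConcaveGrowth.tendsto_div_scale (h0 : Q 0 = 0) (hγ : γ < 0) :
    Tendsto (fun n : ℕ => Q (1 / n) / a n) atTop (𝓝 (1 / -γ)) := by
  set g := -γ with hg
  have hg0 : 0 < g := by linarith
  have hR : ∀ s, evQuantile γ s = (s ^ g - 1) / g := by
    intro s
    rw [evQuantile, if_neg hγ.ne, ← hg, show γ = -g by rw [hg, neg_neg], div_neg, ← neg_div,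
      neg_sub]
  have hq1 : (1 / 2 : ℝ) ^ g < 1 := Real.rpow_lt_one (by norm_num) (by norm_num) hg0
  have hq0 : 0 < (1 / 2 : ℝ) ^ g := Real.rpow_pos_of_pos (by norm_num) _
  have h14 : (1 / 4 : ℝ) ^ g = (1 / 2 : ℝ) ^ g * (1 / 2 : ℝ) ^ g := by
    rw [← Real.mul_rpow (by norm_num) (by norm_num)]; norm_num
  set q := (1 / 2 : ℝ) ^ g with hq
  have hupper : ∀ r, q < r → r < 1 →
      ∀ᶠ n : ℕ in atTop, Q (1 / n) ≤ (Q (1 / n) - Q ((1 / 2) / n)) / (1 - r) := by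
    intro r hqr hr1
    have hD1 := (hinc 1 (1 / 2) (by norm_num) (by norm_num)).const_mul r
    have hD2 := hinc (1 / 2) (1 / 4) (by norm_num) (by norm_num)
    simp only [hR, Real.one_rpow, h14] at hD1 hD2
    have hev : ∀ᶠ n : ℕ in atTop,
        Q ((1 / 2) / n) - Q ((1 / 4) / n) ≤ r * (Q (1 / n) - Q ((1 / 2) / n)) := by
      have hlt : (q - 1) / g - (q * q - 1) / g < r * ((1 - 1) / g - (q - 1) / g) := by
        rw [← sub_div, ← sub_div, ← mul_div_assoc, div_lt_div_iff_of_pos_right hg0]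
        nlinarith
      filter_upwards [hD2.eventually_lt hD1 hlt] with n hn
      rw [← mul_div_assoc, div_lt_div_iff_of_pos_right (ha n)] at hn
      exact hn.le
    obtain ⟨N, hN⟩ := eventually_atTop.1 hev
    filter_upwards [eventually_ge_atTop (N + 1)] with n hn
    have hn0 : (0 : ℝ) < n := by exact_mod_cast (by omega : 0 < n)
    -- The dyadic points are reciprocals of the integers n 2^k ≥ N, so the ratio bound applies at
    -- every level.
    set t : ℕ → ℝ := fun k => 1 / ((n * 2 ^ k : ℕ) : ℝ) with ht
    have ht2 : ∀ k, t (k + 1) = (1 / 2) / ((n * 2 ^ k : ℕ) : ℝ) := by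
      intro k
      simp only [ht]
      push_cast
      field_simp
      ring
    have ht4 : ∀ k, t (k + 2) = (1 / 4) / ((n * 2 ^ k : ℕ) : ℝ) := by
      intro k
      simp only [ht]
      push_cast
      field_simp
      ring
    -- This replaces the geometric series: the sequence increases to 0, so its term at k = 0 is at
    -- most 0, which is the claim.
    have hmono : Monotone fun k => Q (t k) - (Q (t k) - Q (t (k + 1))) / (1 - r) := by
      refine monotone_nat_of_le_succ fun k => ?_
      have hk := hN (n * 2 ^ k) (by
        have : n * 1 ≤ n * 2 ^ k := Nat.mul_le_mul_left n Nat.one_le_two_pow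
        omega)
      rw [← ht2, ← ht4] at hk
      change _ ≤ r * (Q (t k) - Q (t (k + 1))) at hk
      have hr : 0 < 1 - r := by linarith
      have e : Q (t (k + 1)) - (Q (t (k + 1)) - Q (t (k + 1 + 1))) / (1 - r) -
          (Q (t k) - (Q (t k) - Q (t (k + 1))) / (1 - r)) =
          (r * (Q (t k) - Q (t (k + 1))) - (Q (t (k + 1)) - Q (t (k + 2)))) / (1 - r) := by
        field_simp
        ring
      have : 0 ≤ (r * (Q (t k) - Q (t (k + 1))) - (Q (t (k + 1)) - Q (t (k + 2)))) / (1 - r) :=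
        div_nonneg (by linarith) hr.le
      linarith
    have htlim : Tendsto t atTop (𝓝[>] 0) := by
      refine (tendsto_div_nat_nhdsGT one_pos).comp (tendsto_atTop_mono (fun k => ?_)
        tendsto_id)
      calc k ≤ 2 ^ k := Nat.lt_two_pow_self.le
        _ ≤ n * 2 ^ k := Nat.le_mul_of_pos_left _ (by omega)
    have hQt : Tendsto (fun k => Q (t k)) atTop (𝓝 0) := by
      have := hQ.tendsto_zero.comp htlim
      rwa [h0] at this
    have hlim : Tendsto (fun k => Q (t k) - (Q (t k) - Q (t (k + 1))) / (1 - r)) atTop (𝓝 0) := by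
      simpa using hQt.sub ((hQt.sub (hQt.comp (tendsto_add_atTop_nat 1))).div_const (1 - r))
    have hfin := hmono.ge_of_tendsto hlim 0
    have e0 : t 0 = 1 / n := by simp [ht]
    have e1 : t (0 + 1) = (1 / 2) / n := by rw [ht2]; simp
    rw [e1, e0] at hfin
    linarith
  rw [tendsto_order]
  constructor
  · intro y hy
    obtain ⟨s, hys, hs⟩ : ∃ s : ℝ, y < (1 - s ^ g) / g ∧ 0 < s := by
      have hc : Tendsto (fun s : ℝ => (1 - s ^ g) / g) (𝓝[>] 0) (𝓝 (1 / g)) := by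
        have : ContinuousAt (fun s : ℝ => (1 - s ^ g) / g) 0 :=
          (continuousAt_const.sub (Real.continuousAt_rpow_const 0 g (Or.inr hg0.le))).div_const g
        have h := this.tendsto.mono_left (nhdsWithin_le_nhds (s := Set.Ioi 0))
        simpa [Real.zero_rpow hg0.ne'] using h
      exact ((hc.eventually (lt_mem_nhds hy)).and self_mem_nhdsWithin).exists
    have hlim := hinc 1 s one_pos hs
    simp only [hR, Real.one_rpow] at hlim
    have hlt : y < (1 - 1) / g - (s ^ g - 1) / g := by
      rw [← sub_div]
      convert hys using 2
      ring
    filter_upwards [hlim.eventually (lt_mem_nhds hlt)] with n hn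
    refine hn.trans_le (div_le_div_of_nonneg_right ?_ (ha n).le)
    linarith [hQ.nonneg (s / n) (by positivity)]
  · intro y hy
    obtain ⟨r, hry, hqr, hr1⟩ : ∃ r : ℝ, (1 - q) / g / (1 - r) < y ∧ q < r ∧ r < 1 := by
      have hc : Tendsto (fun r : ℝ => (1 - q) / g / (1 - r)) (𝓝[>] q) (𝓝 (1 / g)) := by
        have : ContinuousAt (fun r : ℝ => (1 - q) / g / (1 - r)) q :=
          continuousAt_const.div (by fun_prop) (by linarith)
        have h := this.tendsto.mono_left (nhdsWithin_le_nhds (s := Set.Ioi q))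
        rwa [show (1 - q) / g / (1 - q) = 1 / g by
          rw [div_right_comm, div_self (by linarith)]] at h
      have h1 : ∀ᶠ r in 𝓝[>] q, r < 1 := (gt_mem_nhds hq1).filter_mono nhdsWithin_le_nhds
      exact ((hc.eventually (gt_mem_nhds hy)).and (Eventually.and self_mem_nhdsWithin h1)).exists
    have hlim := (hinc 1 (1 / 2) one_pos (by norm_num)).div_const (1 - r)
    simp only [hR, Real.one_rpow] at hlim
    have hlt : ((1 - 1) / g - (q - 1) / g) / (1 - r) < y := by
      rw [← sub_div]
      convert hry using 3
      ring
    filter_upwards [hlim.eventually (gt_mem_nhds hlt), hupper r hqr hr1] with n hn hn2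
    refine lt_of_le_of_lt ?_ hn
    rw [div_right_comm]
    exact div_le_div_of_nonneg_right hn2 (ha n).le

theorem ConcaveGrowth.tendsto_ratio_of_neg (h0 : Q 0 = 0) (hγ : γ < 0) {s : ℝ} (hs : 0 < s) :
    Tendsto (fun n : ℕ => Q (s / n) / Q (1 / n)) atTop (𝓝 (s ^ (-γ))) := by
  have hscale := hQ.tendsto_div_scale ha hinc h0 hγ
  have hne : 1 / -γ ≠ 0 := by
    have : 0 < 1 / -γ := div_pos one_pos (by linarith)
    exact this.ne'
  have h := ((hinc s 1 hs one_pos).div hscale hne).const_add 1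
  have e : 1 + (evQuantile γ s - evQuantile γ 1) / (1 / -γ) = s ^ (-γ) := by
    rw [evQuantile_one, evQuantile, if_neg hγ.ne]
    have := hγ.ne
    field_simp
    ring
  rw [e] at h
  refine h.congr' ?_
  filter_upwards [eventually_ge_atTop 1] with n hn
  have hn0 : (0 : ℝ) < n := by exact_mod_cast (by omega : 0 < n)
  have hq := hQ.pos (div_pos one_pos hn0)
  have han := ha n
  simp only [Pi.div_apply]
  field_simp
  ring

theorem ConcaveGrowth.exists_tendsto_ratio : ∃ g : ℝ, 0 ≤ g ∧ g ≤ 1 ∧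
    ∀ s, 0 < s → Tendsto (fun n : ℕ => Q (s / n) / Q (1 / n)) atTop (𝓝 (s ^ g)) := by
  rcases (hQ.nonneg 0 le_rfl).eq_or_lt with h0 | h0
  · rcases le_or_gt 0 γ with hγ | hγ
    · refine ⟨0, le_rfl, zero_le_one, fun s hs => ?_⟩
      rw [Real.rpow_zero]
      exact hQ.tendsto_ratio_of_nonneg ha hinc hγ hs
    · exact ⟨-γ, by linarith, by linarith [hQ.neg_one_le ha hinc],
        fun s hs => hQ.tendsto_ratio_of_neg ha hinc h0.symm hγ hs⟩
  · refine ⟨0, le_rfl, zero_le_one, fun s hs => ?_⟩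
    rw [Real.rpow_zero]
    exact hQ.tendsto_ratio_of_pos h0 hs

end

/-- Sequential regular variation at zero implies regular variation at zero. -/
theorem ConcaveGrowth.tendsto_ratio_nhdsGT {Q : ℝ → ℝ} (hQ : ConcaveGrowth Q) {g s : ℝ}
    (hs : 0 < s) (h : Tendsto (fun n : ℕ => Q (s / n) / Q (1 / n)) atTop (𝓝 (s ^ g))) :
    Tendsto (fun t => Q (s * t) / Q t) (𝓝[>] 0) (𝓝 (s ^ g)) := by
  -- With n = ⌊1/t⌋, t lies between 1/(n+1) and 1/n; concavity limits the change of Q across that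
  -- gap to the factor n/(n+1).
  have hfloor : Tendsto (fun t : ℝ => ⌊t⁻¹⌋₊) (𝓝[>] 0) atTop :=
    tendsto_nat_floor_atTop.comp tendsto_inv_nhdsGT_zero
  have hlow : Tendsto (fun n : ℕ => Q (s / n) / Q (1 / n) * ((n : ℝ) / (n + 1))) atTop
      (𝓝 (s ^ g)) := by
    simpa using h.mul (tendsto_natCast_div_add_atTop (1 : ℝ))
  have hup : Tendsto (fun n : ℕ => Q (s / n) / Q (1 / n) / ((n : ℝ) / (n + 1))) atTop
      (𝓝 (s ^ g)) := by
    simpa [Pi.div_def] using h.div (tendsto_natCast_div_add_atTop (1 : ℝ)) one_ne_zero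
  have hcommon : ∀ᶠ t : ℝ in 𝓝[>] 0, 0 < t ∧ (0 : ℝ) < ⌊t⁻¹⌋₊ ∧
      1 / ((⌊t⁻¹⌋₊ : ℝ) + 1) ≤ t ∧ t ≤ 1 / ⌊t⁻¹⌋₊ := by
    filter_upwards [self_mem_nhdsWithin, hfloor.eventually_ge_atTop 1] with t ht ht1
    have ht : 0 < t := ht
    have hn : (0 : ℝ) < ⌊t⁻¹⌋₊ := by exact_mod_cast (by omega : 0 < ⌊t⁻¹⌋₊)
    refine ⟨ht, hn, ?_, ?_⟩
    · rw [one_div, inv_le_comm₀ (by positivity) ht]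
      exact (Nat.lt_floor_add_one _).le
    · rw [one_div, le_inv_comm₀ ht hn]
      exact Nat.floor_le (by positivity)
  have hshrink : ∀ (n : ℕ), (0 : ℝ) < n → ∀ r : ℝ, 0 < r →
      (n : ℝ) / (n + 1) * Q (r / n) ≤ Q (r / (n + 1)) := by
    intro n hn r hr
    have h1 := hQ.mul_le_mul (u := r / (n + 1)) (v := r / n) (by positivity)
      (div_le_div_of_nonneg_left hr.le hn (by linarith))
    have e : r / n * ((n : ℝ) / (n + 1) * Q (r / n)) = r / (n + 1) * Q (r / n) := by
      field_simp
    rw [← e] at h1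
    exact le_of_mul_le_mul_left h1 (by positivity)
  refine tendsto_of_tendsto_of_tendsto_of_le_of_le' (hlow.comp hfloor) (hup.comp hfloor) ?_ ?_
  · filter_upwards [hcommon] with t ⟨ht, hn, h1, h2⟩
    simp only [Function.comp]
    set n := ⌊t⁻¹⌋₊
    have hq1 := hQ.pos (div_pos one_pos hn)
    rw [div_mul_eq_mul_div]
    refine div_le_div₀ (hQ.nonneg _ (by positivity)) ?_ (hQ.pos ht) (hQ.mono ht.le h2)
    rw [mul_comm]
    refine (hshrink n hn s hs).trans (hQ.mono (by positivity) ?_)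
    calc s / (n + 1) = s * (1 / (n + 1)) := by ring
      _ ≤ s * t := by gcongr
  · filter_upwards [hcommon] with t ⟨ht, hn, h1, h2⟩
    simp only [Function.comp]
    set n := ⌊t⁻¹⌋₊
    have hq1 := hQ.pos (div_pos one_pos hn)
    rw [div_div]
    refine div_le_div₀ (hQ.nonneg _ (by positivity)) (hQ.mono (by positivity) ?_)
      (by positivity) ?_
    · calc s * t ≤ s * (1 / n) := by gcongr
        _ = s / n := by ring
    · rw [mul_comm]
      exact (hshrink n hn 1 one_pos).trans (hQ.mono (by positivity) h1)

/-! ### Expected minima and truncated means -/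

theorem integral_expLaw (φ : ℝ → ℝ) :
    ∫ v, φ v ∂expLaw = ∫ v in Set.Ioi 0, Real.exp (-v) * φ v := by
  rw [expLaw, integral_withDensity_eq_integral_toReal_smul (by fun_prop)
    (ae_of_all _ fun _ => ENNReal.ofReal_lt_top)]
  refine integral_congr_ae (ae_of_all _ fun v => ?_)
  simp [ENNReal.toReal_ofReal (Real.exp_pos _).le]

theorem integrable_id_expLaw : Integrable (fun v : ℝ => v) expLaw := by
  refine ⟨by fun_prop, ?_⟩
  rw [hasFiniteIntegral_iff_ofReal (ae_expLaw_pos.mono fun v hv => le_of_lt hv)]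
  have h := lintegral_expLaw_sub le_rfl
  simp only [sub_zero] at h
  rw [h]
  exact ENNReal.ofReal_lt_top

theorem integral_rpow_expLaw {g : ℝ} (hg : 0 ≤ g) :
    ∫ v, v ^ g ∂expLaw = Real.Gamma (1 + g) := by
  rw [integral_expLaw, Real.Gamma_eq_integral (by linarith), add_sub_cancel_left]

theorem expLaw_real_Iio {w : ℝ} (hw : 0 ≤ w) : expLaw.real (Set.Iio w) = 1 - Real.exp (-w) := by
  rw [← Set.compl_Ici, probReal_compl_eq_one_sub measurableSet_Ici, measureReal_def,
    expLaw_Ici hw, ENNReal.toReal_ofReal (Real.exp_pos _).le]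

/-- The expectation of `Q` at a standard exponential random variable, truncated at `c`. -/
noncomputable def truncMean (Q : ℝ → ℝ) (c : ℝ) : ℝ := ∫ v, min (Q v) c ∂expLaw

section

variable {Q : ℝ → ℝ} (hQ : ConcaveGrowth Q)
include hQ

namespace ConcaveGrowth

/-- Monotonicity handles v ≤ 1 and the decrease of Q(u)/u handles v ≥ 1. This is the dominating
function, uniform in n. -/
theorem div_le_one_add {n : ℕ} (hn : n ≠ 0) {v : ℝ} (hv : 0 < v) :
    Q (v / n) / Q (1 / n) ≤ 1 + v := by
  have hn0 : (0 : ℝ) < n := by exact_mod_cast Nat.pos_of_ne_zero hn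
  rw [div_le_iff₀ (hQ.pos (div_pos one_pos hn0))]
  have hq := hQ.nonneg (1 / n) (by positivity)
  rcases le_total v 1 with h | h
  · have := hQ.mono (by positivity) (div_le_div_of_nonneg_right h hn0.le : v / n ≤ 1 / n)
    nlinarith
  · have := hQ.mul_le_mul (by positivity) (div_le_div_of_nonneg_right h hn0.le : 1 / n ≤ v / n)
    rw [div_mul_eq_mul_div, div_mul_eq_mul_div, div_le_div_iff_of_pos_right hn0] at this
    nlinarith

theorem integrable_div {n : ℕ} (hn : n ≠ 0) : Integrable (fun v => Q (v / n)) expLaw := by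
  have hn0 : (0 : ℝ) < n := by exact_mod_cast Nat.pos_of_ne_zero hn
  have hq := hQ.pos (div_pos one_pos hn0)
  refine (((integrable_const 1).add integrable_id_expLaw).const_mul (Q (1 / n))).mono'
    (hQ.measurable_div n).aestronglyMeasurable ?_
  filter_upwards [ae_expLaw_pos] with v hv
  rw [Real.norm_of_nonneg (hQ.nonneg _ (by positivity))]
  have := hQ.div_le_one_add hn hv
  rwa [div_le_iff₀ hq, mul_comm] at this

theorem tendsto_integral_div {g : ℝ} (hg : 0 ≤ g)
    (h : ∀ s, 0 < s → Tendsto (fun n : ℕ => Q (s / n) / Q (1 / n)) atTop (𝓝 (s ^ g))) :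
    Tendsto (fun n : ℕ => (∫ v, Q (v / n) ∂expLaw) / Q (1 / n)) atTop
      (𝓝 (Real.Gamma (1 + g))) := by
  rw [← integral_rpow_expLaw hg]
  simp_rw [← integral_div]
  refine tendsto_integral_filter_of_dominated_convergence (fun v => 1 + v)
    (Eventually.of_forall fun n => ((hQ.measurable_div n).div_const _).aestronglyMeasurable) ?_
    ((integrable_const 1).add integrable_id_expLaw) ?_
  · filter_upwards [eventually_ge_atTop 1] with n hn
    filter_upwards [ae_expLaw_pos] with v hv
    rw [Real.norm_of_nonneg (div_nonneg (hQ.nonneg _ (by positivity))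
      (hQ.nonneg _ (by positivity)))]
    exact hQ.div_le_one_add (by omega) hv
  · filter_upwards [ae_expLaw_pos] with v hv
    exact h v hv

theorem integrable_min {c : ℝ} (hc : 0 ≤ c) : Integrable (fun v => min (Q v) c) expLaw := by
  refine (integrable_const c).mono' (hQ.measurable.min measurable_const).aestronglyMeasurable ?_
  filter_upwards [ae_expLaw_pos] with v hv
  rw [Real.norm_of_nonneg (le_min (hQ.nonneg v hv.le) hc)]
  exact min_le_right _ _

theorem truncMean_mono {c d : ℝ} (hc : 0 ≤ c) (hcd : c ≤ d) : truncMean Q c ≤ truncMean Q d :=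
  integral_mono (hQ.integrable_min hc) (hQ.integrable_min (hc.trans hcd))
    fun _ => min_le_min le_rfl hcd

/-- On {E < w} the truncated variable is at most Q(w), and elsewhere at most c. -/
theorem truncMean_le {c w : ℝ} (hc : 0 ≤ c) (hw : 0 ≤ w) :
    truncMean Q c ≤ c - (1 - Real.exp (-w)) * (c - Q w) := by
  have hi : Integrable (fun v => c - (Set.Iio w).indicator (fun _ => c - Q w) v) expLaw :=
    (integrable_const c).sub ((integrable_const _).indicator measurableSet_Iio)
  have h := integral_mono_ae (hQ.integrable_min hc) hi (by
    filter_upwards [ae_expLaw_pos] with v hv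
    by_cases hvw : v ∈ Set.Iio w
    · simp only [Set.indicator_of_mem hvw, sub_sub_cancel]
      exact (min_le_left _ _).trans (hQ.mono hv.le (le_of_lt hvw))
    · simp [Set.indicator_of_notMem hvw])
  rw [integral_sub (integrable_const c) ((integrable_const _).indicator measurableSet_Iio),
    integral_indicator_const _ measurableSet_Iio, expLaw_real_Iio hw] at h
  simpa [truncMean] using h

theorem sub_truncMean {u : ℝ} (hu : 0 < u) :
    Q u - truncMean Q (Q u) =
      u * Q u * ∫ s in (0 : ℝ)..1, Real.exp (-(s * u)) * (1 - Q (s * u) / Q u) := by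
  have hqu := hQ.pos hu
  have h1 : Q u - truncMean Q (Q u) = ∫ v, (Q u - min (Q v) (Q u)) ∂expLaw := by
    rw [integral_sub (integrable_const _) (hQ.integrable_min hqu.le), truncMean]
    simp
  have h2 : ∫ v in Set.Ioi 0, Real.exp (-v) * (Q u - min (Q v) (Q u)) =
      ∫ v in Set.Ioc 0 u, Real.exp (-v) * (Q u - min (Q v) (Q u)) := by
    refine setIntegral_eq_of_subset_of_forall_sdiff_eq_zero measurableSet_Ioi
      Set.Ioc_subset_Ioi_self fun v hv => ?_
    have hv0 : 0 < v := hv.1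
    have huv : u ≤ v := by
      by_contra! h
      exact hv.2 ⟨hv0, h.le⟩
    rw [min_eq_right (hQ.mono hu.le huv), sub_self, mul_zero]
  have h3 : ∫ v in Set.Ioc 0 u, Real.exp (-v) * (Q u - min (Q v) (Q u)) =
      ∫ v in Set.Ioc 0 u, Real.exp (-v) * (1 - Q v / Q u) * Q u := by
    refine setIntegral_congr_fun measurableSet_Ioc fun v hv => ?_
    rw [min_eq_left (hQ.mono hv.1.le hv.2), mul_assoc, sub_mul, div_mul_cancel₀ _ hqu.ne',
      one_mul]
  rw [h1, integral_expLaw, h2, h3, ← intervalIntegral.integral_of_le hu.le,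
    intervalIntegral.integral_mul_const]
  have h4 := intervalIntegral.mul_integral_comp_mul_right
    (f := fun v => Real.exp (-v) * (1 - Q v / Q u)) (a := 0) (b := 1) u
  rw [zero_mul, one_mul] at h4
  rw [← h4]
  ring

/-- After the substitution v = su the integrand tends to 1 - s^g, whose integral over [0, 1] is
g/(1+g). -/
theorem tendsto_sub_truncMean {g : ℝ} (hg : 0 ≤ g)
    (h : ∀ s, 0 < s → Tendsto (fun t => Q (s * t) / Q t) (𝓝[>] 0) (𝓝 (s ^ g))) :
    Tendsto (fun u => (Q u - truncMean Q (Q u)) / (u * Q u)) (𝓝[>] 0) (𝓝 (g / (1 + g))) := by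
  have hint : ∫ s in (0 : ℝ)..1, (1 - s ^ g) = g / (1 + g) := by
    rw [intervalIntegral.integral_sub intervalIntegrable_const
      (intervalIntegral.intervalIntegrable_rpow' (by linarith)),
      integral_rpow (Or.inl (by linarith))]
    simp only [intervalIntegral.integral_const, Real.one_rpow,
      Real.zero_rpow (by linarith : g + 1 ≠ 0)]
    have : g + 1 ≠ 0 := by linarith
    have : 1 + g ≠ 0 := by linarith
    simp only [smul_eq_mul]
    field_simp
    ring
  rw [← hint]
  have hdom : Tendsto (fun u => ∫ s in (0 : ℝ)..1, Real.exp (-(s * u)) * (1 - Q (s * u) / Q u))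
      (𝓝[>] 0) (𝓝 (∫ s in (0 : ℝ)..1, (1 - s ^ g))) := by
    refine intervalIntegral.tendsto_integral_filter_of_dominated_convergence (fun _ => 1) ?_ ?_
      intervalIntegrable_const ?_
    · refine Eventually.of_forall fun u => Measurable.aestronglyMeasurable ?_
      have : Measurable fun s => Q (s * u) := hQ.measurable.comp (measurable_id.mul_const u)
      exact (by fun_prop : Measurable fun s : ℝ => Real.exp (-(s * u))).mul
        ((this.div_const _).const_sub 1)
    · filter_upwards [self_mem_nhdsWithin] with u hu
      have hu : 0 < u := hu
      refine ae_of_all _ fun s hs => ?_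
      rw [Set.uIoc_of_le zero_le_one] at hs
      have hsu : 0 < s * u := mul_pos hs.1 hu
      have hqu := hQ.pos hu
      have h1 : Q (s * u) / Q u ≤ 1 := by
        rw [div_le_one hqu]
        exact hQ.mono hsu.le (by nlinarith [hs.2])
      have h2 : 0 ≤ Q (s * u) / Q u := div_nonneg (hQ.nonneg _ hsu.le) hqu.le
      have h3 : Real.exp (-(s * u)) ≤ 1 := Real.exp_le_one_iff.2 (by linarith)
      have h4 := Real.exp_pos (-(s * u))
      rw [Real.norm_of_nonneg (mul_nonneg h4.le (by linarith))]
      nlinarith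
    · refine ae_of_all _ fun s hs => ?_
      rw [Set.uIoc_of_le zero_le_one] at hs
      have he : Tendsto (fun u : ℝ => Real.exp (-(s * u))) (𝓝[>] 0) (𝓝 1) := by
        have : Continuous fun u : ℝ => Real.exp (-(s * u)) := by fun_prop
        simpa using (this.tendsto 0).mono_left nhdsWithin_le_nhds
      simpa using he.mul ((h s hs.1).const_sub 1)
  refine hdom.congr' ?_
  filter_upwards [self_mem_nhdsWithin] with u hu
  have hu : 0 < u := hu
  have := hQ.pos hu
  rw [hQ.sub_truncMean hu, mul_div_cancel_left₀ _ (mul_pos hu this).ne']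

theorem secant_le {x y z : ℝ} (hx : 0 ≤ x) (hxy : x ≤ y) (hyz : y ≤ z) :
    (z - x) * (Q z - Q y) ≤ (z - y) * (Q z - Q x) := by
  rcases hxy.eq_or_lt with rfl | hxy
  · rfl
  rcases hyz.eq_or_lt with rfl | hyz
  · simp
  have h := hQ.concave.slope_anti_adjacent (Set.mem_Ici.2 hx)
    (Set.mem_Ici.2 (by linarith : 0 ≤ z)) hxy hyz
  rw [div_le_div_iff₀ (by linarith) (by linarith)] at h
  nlinarith

theorem secant_adjacent_le {x y z : ℝ} (hx : 0 ≤ x) (hxy : x ≤ y) (hyz : y ≤ z) :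
    (y - x) * (Q z - Q y) ≤ (z - y) * (Q y - Q x) := by
  have := hQ.secant_le hx hxy hyz
  nlinarith

end ConcaveGrowth

end

/-! ### One step of the recursion -/

section Step

variable {Q : ℝ → ℝ} (hQ : ConcaveGrowth Q)
include hQ

/-- One step of the recursion increases the reciprocal of the argument by at least `1 / 8`. -/
theorem ConcaveGrowth.truncMean_le_eighth : ∀ᶠ u in 𝓝[>] 0,
    truncMean Q (Q u) ≤ Q (u / (1 + 1 / 8 * u)) := by
  filter_upwards [Ioo_mem_nhdsGT (zero_lt_one' ℝ)] with u ⟨hu0, hu1⟩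
  -- The constant is 1/4 · 1/2: {E < u/2} has probability at least u/4 and saves at least Q(u) -
  -- Q(u/2) there, while u - w ≤ u²/8 is at most the fraction u/4 of the interval [u/2, u].
  set w := u / (1 + 1 / 8 * u) with hw
  have hd : 0 < 1 + 1 / 8 * u := by positivity
  have hwu : w ≤ u := div_le_self hu0.le (by linarith)
  have hw2 : u / 2 ≤ w := div_le_div_of_nonneg_left hu0.le hd (by linarith)
  have huw : u - w ≤ 1 / 8 * u ^ 2 := by
    have : u - w = 1 / 8 * u ^ 2 / (1 + 1 / 8 * u) := by rw [hw]; field_simp; ring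
    rw [this]
    exact div_le_self (by positivity) (by linarith)
  have h1 := hQ.truncMean_le (hQ.nonneg u hu0.le) (half_pos hu0).le
  have h2 := hQ.secant_le (half_pos hu0).le hw2 hwu
  have hgap : 0 ≤ Q u - Q (u / 2) := sub_nonneg.2 (hQ.mono (half_pos hu0).le (by linarith))
  have hexp : u / 4 ≤ 1 - Real.exp (-(u / 2)) := by
    have h3 : Real.exp (-(u / 2)) * (1 + u / 2) ≤ 1 := by
      rw [Real.exp_neg, inv_mul_le_iff₀ (Real.exp_pos _), mul_one]
      linarith [Real.add_one_le_exp (u / 2)]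
    have h5 : 1 ≤ (1 - u / 4) * (1 + u / 2) := by nlinarith
    have h4 : Real.exp (-(u / 2)) ≤ 1 - u / 4 :=
      le_of_mul_le_mul_right (h3.trans h5) (by linarith)
    linarith
  have h3 : (u - u / 2) * (Q u - Q w) ≤ 1 / 8 * u ^ 2 * (Q u - Q (u / 2)) :=
    h2.trans (mul_le_mul_of_nonneg_right huw hgap)
  have h4 : Q u - Q w ≤ u / 4 * (Q u - Q (u / 2)) := by
    have : u / 2 * (Q u - Q w) ≤ u / 2 * (u / 4 * (Q u - Q (u / 2))) := by nlinarith
    exact le_of_mul_le_mul_left this (half_pos hu0)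
  have h5 := mul_le_mul_of_nonneg_right hexp hgap
  linarith

omit hQ in
theorem tendsto_slope_rpow_one (g : ℝ) :
    Tendsto (fun θ : ℝ => (θ ^ g - 1) / (θ - 1)) (𝓝[≠] 1) (𝓝 g) := by
  have h := (Real.hasDerivAt_rpow_const (x := 1) (p := g) (Or.inl one_ne_zero)).tendsto_slope
  rw [Real.one_rpow, mul_one] at h
  refine h.congr fun θ => ?_
  rw [slope_def_field, Real.one_rpow]

/-- A step lowers Q(u) by about u Q(u) g/(1+g), and passing from u to u/(1 + βu) lowers it by about
β g u Q(u); so β(1+g) < 1 decides the comparison. The second drop is bounded by the chord over [θu,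
u], with θ < 1 close enough to 1 for its slope to be nearly g Q(u)/u. -/
theorem ConcaveGrowth.truncMean_le_of_lt {g β : ℝ} (hg : 0 < g) (hβ : 0 < β)
    (hβg : β * (1 + g) < 1)
    (h : ∀ s, 0 < s → Tendsto (fun t => Q (s * t) / Q t) (𝓝[>] 0) (𝓝 (s ^ g))) :
    ∀ᶠ u in 𝓝[>] 0, truncMean Q (Q u) ≤ Q (u / (1 + β * u)) := by
  have hlt : β * g < g / (1 + g) := by
    rw [lt_div_iff₀ (by linarith)]; nlinarith
  obtain ⟨θ, hθ, hθ0, hθ1⟩ : ∃ θ : ℝ, β * ((θ ^ g - 1) / (θ - 1)) < g / (1 + g) ∧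
      0 < θ ∧ θ < 1 := by
    have h1 := ((tendsto_slope_rpow_one g).mono_left
      (nhdsWithin_mono 1 (fun x hx => ne_of_lt hx : Set.Iio (1 : ℝ) ⊆ {1}ᶜ))).const_mul β
    have h2 : ∀ᶠ x : ℝ in 𝓝[<] 1, 0 < x :=
      (lt_mem_nhds one_pos).filter_mono nhdsWithin_le_nhds
    exact ((h1.eventually (gt_mem_nhds hlt)).and (h2.and self_mem_nhdsWithin)).exists
  have hl := (((h θ hθ0).sub_const 1).div_const (θ - 1)).const_mul β
  have hsmall : ∀ᶠ u : ℝ in 𝓝[>] 0, θ * (1 + β * u) < 1 := by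
    have : Continuous fun u : ℝ => θ * (1 + β * u) := by fun_prop
    exact ((this.tendsto 0).eventually (gt_mem_nhds (by simpa using hθ1))).filter_mono
      nhdsWithin_le_nhds
  filter_upwards [hl.eventually_lt (hQ.tendsto_sub_truncMean hg.le h) hθ, hsmall,
    self_mem_nhdsWithin] with u hu hus hu0
  have hu0 : 0 < u := hu0
  have hqu := hQ.pos hu0
  have hd : 0 < 1 + β * u := by positivity
  set w := u / (1 + β * u) with hw
  have hwu : w ≤ u := div_le_self hu0.le (by nlinarith)
  have hθw : θ * u ≤ w := by
    rw [hw, le_div_iff₀ hd]; nlinarith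
  have huw : u - w ≤ β * u ^ 2 := by
    have : u - w = β * u ^ 2 / (1 + β * u) := by rw [hw]; field_simp; ring
    rw [this]
    exact div_le_self (by positivity) (by nlinarith)
  have h1 := hQ.secant_le (by positivity) hθw hwu
  have hgap : 0 ≤ Q u - Q (θ * u) := sub_nonneg.2 (hQ.mono (by positivity) (by nlinarith))
  have h2 : (u - θ * u) * (Q u - Q w) ≤ β * u ^ 2 * (Q u - Q (θ * u)) :=
    h1.trans (mul_le_mul_of_nonneg_right huw hgap)
  rw [lt_div_iff₀ (by positivity)] at hu
  have e : β * ((Q (θ * u) / Q u - 1) / (θ - 1)) * (u * Q u) =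
      β * u ^ 2 * (Q u - Q (θ * u)) / (u - θ * u) := by
    have h1 : θ - 1 ≠ 0 := by linarith
    have h2 : 1 - θ ≠ 0 := by linarith
    have h3 : u - θ * u ≠ 0 := by
      have : u - θ * u = u * (1 - θ) := by ring
      rw [this]; exact mul_ne_zero hu0.ne' h2
    field_simp
    ring
  rw [e] at hu
  have hpos : 0 < u - θ * u := by nlinarith
  have h3 : Q u - Q w ≤ β * u ^ 2 * (Q u - Q (θ * u)) / (u - θ * u) := by
    rw [le_div_iff₀ hpos]; linarith
  linarith

/-- The reverse comparison takes θ > 1: by concavity the chord over [u, θu] is no steeper than the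
one over [w, u]. -/
theorem ConcaveGrowth.le_truncMean_of_lt {g β : ℝ} (hg : 0 < g) (hβ : 0 < β)
    (hβg : 1 < β * (1 + g))
    (h : ∀ s, 0 < s → Tendsto (fun t => Q (s * t) / Q t) (𝓝[>] 0) (𝓝 (s ^ g))) :
    ∀ᶠ u in 𝓝[>] 0, Q (u / (1 + β * u)) ≤ truncMean Q (Q u) := by
  have hlt : g / (1 + g) < β * g := by
    rw [div_lt_iff₀ (by linarith)]; nlinarith
  obtain ⟨θ, hθ, hθ1⟩ : ∃ θ : ℝ, g / (1 + g) < β * ((θ ^ g - 1) / (θ - 1)) ∧ 1 < θ := by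
    have h1 := ((tendsto_slope_rpow_one g).mono_left
      (nhdsWithin_mono 1 (fun x hx => ne_of_gt hx : Set.Ioi (1 : ℝ) ⊆ {1}ᶜ))).const_mul β
    exact ((h1.eventually (lt_mem_nhds hlt)).and self_mem_nhdsWithin).exists
  have hinv : Tendsto (fun u : ℝ => β / (1 + β * u)) (𝓝[>] 0) (𝓝 β) := by
    have : ContinuousAt (fun u : ℝ => β / (1 + β * u)) 0 :=
      continuousAt_const.div (by fun_prop) (by simp)
    simpa using this.tendsto.mono_left (nhdsWithin_le_nhds (s := Set.Ioi 0))
  have hl := hinv.mul (((h θ (by linarith)).sub_const 1).div_const (θ - 1))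
  filter_upwards [(hQ.tendsto_sub_truncMean hg.le h).eventually_lt hl hθ,
    self_mem_nhdsWithin] with u hu hu0
  have hu0 : 0 < u := hu0
  have hqu := hQ.pos hu0
  have hd : 0 < 1 + β * u := by positivity
  set w := u / (1 + β * u) with hw
  have hw0 : 0 ≤ w := by positivity
  have hwu : w ≤ u := div_le_self hu0.le (by nlinarith)
  have huw : u - w = β * u ^ 2 / (1 + β * u) := by rw [hw]; field_simp; ring
  have hpos : 0 < θ - 1 := by linarith
  have h1 := hQ.secant_adjacent_le hw0 hwu (by nlinarith : u ≤ θ * u)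
  rw [div_lt_iff₀ (by positivity)] at hu
  have e : β / (1 + β * u) * ((Q (θ * u) / Q u - 1) / (θ - 1)) * (u * Q u) =
      (u - w) * (Q (θ * u) - Q u) / (θ * u - u) := by
    have h3 : θ * u - u ≠ 0 := by nlinarith
    rw [huw]
    field_simp
  rw [e] at hu
  have h3 : (u - w) * (Q (θ * u) - Q u) / (θ * u - u) ≤ Q u - Q w := by
    rw [div_le_iff₀ (by nlinarith)]; linarith
  linarith

end Step

/-! ### Iterating the recursion -/

section Iterate

variable {Q : ℝ → ℝ} (hQ : ConcaveGrowth Q) {c : ℕ → ℝ} (hc : ∀ n, 0 ≤ c n)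
  (hrec : ∀ n, 1 ≤ n → c (n + 1) = truncMean Q (c n))
include hQ hc hrec

/-- While c_n stays above Q(u), every step loses at least the fixed amount δ, which cannot go on
because c_n ≥ 0. -/
theorem ConcaveGrowth.exists_le {u : ℝ} (hu : 0 < u) : ∃ n, 1 ≤ n ∧ c n ≤ Q u := by
  by_contra! hcon
  set δ := (1 - Real.exp (-(u / 2))) * (Q u - Q (u / 2)) with hδ
  have hexp : 0 < 1 - Real.exp (-(u / 2)) := by
    rw [sub_pos, Real.exp_lt_one_iff]; linarith
  have hδ0 : 0 < δ := mul_pos hexp (sub_pos.2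
    (hQ.strictMono (Set.mem_Ici.2 (by linarith)) (Set.mem_Ici.2 hu.le) (by linarith)))
  have hdec : ∀ k : ℕ, c (1 + k) ≤ c 1 - k * δ := by
    intro k
    induction k with
    | zero => simp
    | succ k ih =>
      rw [← add_assoc, hrec _ (by omega)]
      have h1 := hQ.truncMean_le (hc (1 + k)) (half_pos hu).le
      have h2 := mul_le_mul_of_nonneg_left
        (sub_le_sub_right (hcon (1 + k) (by omega)).le (Q (u / 2))) hexp.le
      push_cast
      linarith
  obtain ⟨k, hk⟩ := exists_nat_gt (c 1 / δ)
  rw [div_lt_iff₀ hδ0] at hk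
  linarith [hdec k, hc (1 + k)]

/-- Once c_N ≤ Q(u) with u small, each step adds at least β to the reciprocal argument. -/
theorem ConcaveGrowth.eventually_le {β x : ℝ} (hβ : 0 < β) (hx : 0 < x) (hβx : 1 < β * x)
    (hstep : ∀ᶠ u in 𝓝[>] 0, truncMean Q (Q u) ≤ Q (u / (1 + β * u))) :
    ∀ᶠ n : ℕ in atTop, c n ≤ Q (x / n) := by
  obtain ⟨u, hu0, hu⟩ := mem_nhdsGT_iff_exists_Ioc_subset.1 hstep
  have hu0 : 0 < u := hu0
  obtain ⟨N, hN1, hN⟩ := hQ.exists_le hc hrec hu0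
  have key : ∀ k : ℕ, c (N + k) ≤ Q (u / (1 + β * k * u)) := by
    intro k
    induction k with
    | zero => simpa using hN
    | succ k ih =>
      have hd : 0 < 1 + β * k * u := by positivity
      have hd' : 0 < 1 + β * (k + 1) * u := by positivity
      rw [← add_assoc, hrec _ (by omega)]
      have hmem : u / (1 + β * k * u) ∈ Set.Ioc 0 u := by
        refine ⟨by positivity, div_le_self hu0.le ?_⟩
        have : 0 ≤ β * k * u := by positivity
        linarith
      refine (hQ.truncMean_mono (hc _) ih).trans ((hu hmem).trans (le_of_eq ?_))
      congr 1
      push_cast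
      field_simp
      ring
  -- The slack βx > 1 absorbs the initial N steps: M is chosen so that N + k ≤ βxk.
  obtain ⟨M, hM⟩ := exists_nat_gt (β * x * N / (β * x - 1))
  rw [div_lt_iff₀ (by linarith)] at hM
  filter_upwards [eventually_ge_atTop (max N (M + 1))] with n hn
  obtain ⟨k, rfl⟩ : ∃ k, n = N + k := ⟨n - N, by omega⟩
  have hMk : (M : ℝ) + 1 ≤ (N + k : ℕ) := by exact_mod_cast (by omega : M + 1 ≤ N + k)
  have hn0 : (0 : ℝ) < (N + k : ℕ) := by
    have : (0 : ℝ) ≤ M := M.cast_nonneg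
    linarith
  refine (key k).trans (hQ.mono (by positivity) ?_)
  rw [div_le_div_iff₀ (by positivity) hn0]
  push_cast at hMk ⊢
  have h1 : (N : ℝ) + k ≤ β * x * k := by nlinarith
  nlinarith [mul_le_mul_of_nonneg_right h1 hu0.le]

omit hc in
theorem ConcaveGrowth.eventually_ge {β x : ℝ} (hβ : 0 < β) (hx : 0 < x) (hβx : β * x < 1)
    (h0 : Q 0 = 0) (hpos : ∃ n, 1 ≤ n ∧ 0 < c n)
    (hstep : ∀ᶠ u in 𝓝[>] 0, Q (u / (1 + β * u)) ≤ truncMean Q (Q u)) :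
    ∀ᶠ n : ℕ in atTop, Q (x / n) ≤ c n := by
  obtain ⟨r, hr0, hr⟩ := mem_nhdsGT_iff_exists_Ioc_subset.1 hstep
  obtain ⟨N, hN1, hNpos⟩ := hpos
  -- Q(0) = 0 and continuity at 0 allow a start strictly below the positive value c_N.
  obtain ⟨u, hN, hu0, hur⟩ : ∃ u, Q u < c N ∧ 0 < u ∧ u < r := by
    have h1 := hQ.tendsto_zero.eventually (gt_mem_nhds (h0.trans_lt hNpos))
    exact (h1.and (Ioo_mem_nhdsGT hr0)).exists
  have key : ∀ k : ℕ, Q (u / (1 + β * k * u)) ≤ c (N + k) := by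
    intro k
    induction k with
    | zero => simpa using hN.le
    | succ k ih =>
      have hd : 0 < 1 + β * k * u := by positivity
      have hd' : 0 < 1 + β * (k + 1) * u := by positivity
      rw [← add_assoc, hrec _ (by omega)]
      have hmem : u / (1 + β * k * u) ∈ Set.Ioc 0 r := by
        refine ⟨by positivity, (div_le_self hu0.le ?_).trans hur.le⟩
        have : 0 ≤ β * k * u := by positivity
        linarith
      refine le_trans (le_of_eq ?_) ((hr hmem).trans
        (hQ.truncMean_mono (hQ.nonneg _ hmem.1.le) ih))
      congr 1
      push_cast
      field_simp
      ring
  obtain ⟨M, hM⟩ := exists_nat_gt (x / u / (1 - β * x))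
  rw [div_lt_iff₀ (by linarith), div_lt_iff₀ hu0] at hM
  filter_upwards [eventually_ge_atTop (max N (M + 1))] with n hn
  obtain ⟨k, rfl⟩ : ∃ k, n = N + k := ⟨n - N, by omega⟩
  have hMk : (M : ℝ) + 1 ≤ (N + k : ℕ) := by exact_mod_cast (by omega : M + 1 ≤ N + k)
  have hn0 : (0 : ℝ) < (N + k : ℕ) := by
    have : (0 : ℝ) ≤ M := M.cast_nonneg
    linarith
  refine (hQ.mono (by positivity) ?_).trans (key k)
  rw [div_le_div_iff₀ hn0 (by positivity)]
  push_cast at hMk ⊢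
  have hNn : (0 : ℝ) ≤ N := N.cast_nonneg
  have hxb : 0 < 1 - β * x := by linarith
  have h1 : x ≤ (N + k) * (1 - β * x) * u := by
    refine hM.le.trans ?_
    gcongr
    linarith
  have h2 : 0 ≤ β * x * N * u := by positivity
  nlinarith

theorem ConcaveGrowth.tendsto_recursion_div {g : ℝ} (hg : 0 ≤ g)
    (h : ∀ s, 0 < s → Tendsto (fun n : ℕ => Q (s / n) / Q (1 / n)) atTop (𝓝 (s ^ g)))
    (hlow : ∀ n : ℕ, 1 ≤ n → ∫ v, Q (v / n) ∂expLaw ≤ c n) :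
    Tendsto (fun n : ℕ => c n / Q (1 / n)) atTop (𝓝 ((1 + g) ^ g)) := by
  have hqpos : ∀ n : ℕ, 1 ≤ n → 0 < Q (1 / n) := by
    intro n hn
    have hn0 : (0 : ℝ) < n := by exact_mod_cast (by omega : 0 < n)
    exact hQ.pos (by positivity)
  have hmean := hQ.tendsto_integral_div hg h
  rcases hg.eq_or_lt with rfl | hg
  · rw [add_zero, Real.Gamma_one] at hmean
    rw [Real.rpow_zero]
    -- For g = 0 every Q(s/n)/Q(1/n) tends to 1, so any s with s/8 > 1 serves; the lower bound is
    -- the prophet, as Γ(1) = 1.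
    have hup := h 16 (by norm_num)
    rw [Real.rpow_zero] at hup
    refine tendsto_of_tendsto_of_tendsto_of_le_of_le' hmean hup ?_ ?_
    · filter_upwards [eventually_ge_atTop 1] with n hn
      exact div_le_div_of_nonneg_right (hlow n hn) (hqpos n hn).le
    · filter_upwards [eventually_ge_atTop 1, hQ.eventually_le hc hrec (x := 16)
        (by norm_num) (by norm_num) (by norm_num) hQ.truncMean_le_eighth] with n hn hle
      exact div_le_div_of_nonneg_right hle (hqpos n hn).le
  · have hreg : ∀ s, 0 < s → Tendsto (fun t => Q (s * t) / Q t) (𝓝[>] 0) (𝓝 (s ^ g)) :=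
      fun s hs => hQ.tendsto_ratio_nhdsGT hs (h s hs)
    -- A positive Q(0) would make all ratios tend to 1, contradicting (1/2)^g < 1.
    have h0 : Q 0 = 0 := by
      by_contra hne
      have h1 := hQ.tendsto_ratio_of_pos ((hQ.nonneg 0 le_rfl).lt_of_ne' hne)
        (by norm_num : (0 : ℝ) < 1 / 2)
      have h2 := tendsto_nhds_unique h1 (h (1 / 2) (by norm_num))
      exact absurd h2 (Real.rpow_lt_one (by norm_num) (by norm_num) hg).ne'
    have hpos : ∃ n, 1 ≤ n ∧ 0 < c n := by
      have hG : 0 < Real.Gamma (1 + g) := Real.Gamma_pos_of_pos (by linarith)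
      obtain ⟨n, hn, hn1⟩ := ((hmean.eventually (lt_mem_nhds hG)).and
        (eventually_ge_atTop 1)).exists
      refine ⟨n, hn1, lt_of_lt_of_le ?_ (hlow n hn1)⟩
      exact (div_pos_iff_of_pos_right (hqpos n hn1)).1 hn
    have hcont : ContinuousAt (fun x : ℝ => x ^ g) (1 + g) :=
      Real.continuousAt_rpow_const _ _ (Or.inr hg.le)
    rw [tendsto_order]
    constructor
    · intro y hy
      obtain ⟨x, hyx, hx0, hxg⟩ : ∃ x : ℝ, y < x ^ g ∧ 0 < x ∧ x < 1 + g := by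
        have h1 : ∀ᶠ x in 𝓝[<] (1 + g), y < x ^ g :=
          (hcont.eventually (lt_mem_nhds hy)).filter_mono nhdsWithin_le_nhds
        have h2 : ∀ᶠ x in 𝓝[<] (1 + g), 0 < x :=
          (lt_mem_nhds (by linarith)).filter_mono nhdsWithin_le_nhds
        exact (h1.and (h2.and self_mem_nhdsWithin)).exists
      -- With x < z < 1 + g, the rate β = 1/z satisfies both strict conditions, βx < 1 and β(1+g) >
      -- 1.
      obtain ⟨z, hxz, hzg⟩ := exists_between hxg
      have hz0 : 0 < z := hx0.trans hxz
      have hge := hQ.eventually_ge hrec (β := z⁻¹) (inv_pos.2 hz0) hx0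
        (by rwa [inv_mul_lt_iff₀ hz0, mul_one]) h0 hpos
        (hQ.le_truncMean_of_lt hg (inv_pos.2 hz0)
          (by rwa [lt_inv_mul_iff₀ hz0, mul_one]) hreg)
      filter_upwards [eventually_ge_atTop 1, hge, (h x hx0).eventually (lt_mem_nhds hyx)]
        with n hn hle hlt
      exact hlt.trans_le (div_le_div_of_nonneg_right hle (hqpos n hn).le)
    · intro y hy
      obtain ⟨x, hyx, hxg⟩ : ∃ x : ℝ, x ^ g < y ∧ 1 + g < x := by
        have h1 : ∀ᶠ x in 𝓝[>] (1 + g), x ^ g < y :=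
          (hcont.eventually (gt_mem_nhds hy)).filter_mono nhdsWithin_le_nhds
        exact (h1.and self_mem_nhdsWithin).exists
      obtain ⟨z, hgz, hzx⟩ := exists_between hxg
      have hz0 : 0 < z := by linarith
      have hx0 : 0 < x := by linarith
      have hle := hQ.eventually_le hc hrec (β := z⁻¹) (inv_pos.2 hz0) hx0
        (by rwa [lt_inv_mul_iff₀ hz0, mul_one])
        (hQ.truncMean_le_of_lt hg (inv_pos.2 hz0)
          (by rwa [inv_mul_lt_iff₀ hz0, mul_one]) hreg)
      filter_upwards [eventually_ge_atTop 1, hle, (h x hx0).eventually (gt_mem_nhds hyx)]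
        with n hn hle hlt
      exact (div_le_div_of_nonneg_right hle (hqpos n hn).le).trans_lt hlt

end Iterate

/-! ### The constant 2 and the conclusion for minima -/

/-- Since (1+g)^g ≤ 2^g, it suffices that Γ(1+g) ≥ 2^(g-1). By convexity, the slope of log Γ on
[1+g, 2] is at most its slope on [2, 3], which is log 2. -/
theorem rpow_div_Gamma_le_two {g : ℝ} (hg0 : 0 ≤ g) (hg1 : g ≤ 1) :
    (1 + g) ^ g / Real.Gamma (1 + g) ≤ 2 := by
  have hG : 0 < Real.Gamma (1 + g) := Real.Gamma_pos_of_pos (by linarith)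
  rw [div_le_iff₀ hG]
  have h1 : (1 + g) ^ g ≤ 2 ^ g := Real.rpow_le_rpow (by linarith) (by linarith) hg0
  refine h1.trans ?_
  have hkey : (g - 1) * Real.log 2 ≤ Real.log (Real.Gamma (1 + g)) := by
    rcases hg1.eq_or_lt with rfl | hg1
    · norm_num [Real.Gamma_two]
    have h2 := Real.convexOn_log_Gamma.slope_mono_adjacent (x := 1 + g) (y := 2) (z := 3)
      (Set.mem_Ioi.2 (by linarith)) (Set.mem_Ioi.2 (by norm_num)) (by linarith) (by norm_num)
    have h3 : Real.Gamma 3 = 2 := by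
      simp [Real.Gamma_ofNat_eq_factorial, Nat.factorial]
    simp only [Function.comp, Real.Gamma_two, Real.log_one, h3] at h2
    rw [div_le_iff₀ (by linarith)] at h2
    norm_num at h2
    linarith
  have h4 := Real.exp_le_exp.2 hkey
  rw [Real.exp_log hG, mul_comm, ← Real.rpow_def_of_pos two_pos, Real.rpow_sub two_pos,
    Real.rpow_one] at h4
  linarith

section Main

variable {μ : Measure ℝ} [IsProbabilityMeasure μ]

theorem IsMHR.prophetMin_eq_ofReal (hμ : IsMHR μ) {n : ℕ} (hn : n ≠ 0) :
    prophetMin μ n = ENNReal.ofReal (∫ v, quantile μ (v / n) ∂expLaw) := by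
  rw [hμ.prophetMin_eq hn, ofReal_integral_eq_lintegral_ofReal (hμ.concaveGrowth.integrable_div hn)]
  filter_upwards [ae_expLaw_pos] with v hv
  exact hμ.concaveGrowth.nonneg _ (by positivity)

theorem IsMHR.optMin_ne_top (hμ : IsMHR μ) (n : ℕ) : optMin μ (n + 1) ≠ ∞ := by
  induction n with
  | zero =>
    have h := hμ.concaveGrowth.integrable_div one_ne_zero
    rw [zero_add, optMin_one, hμ.lintegral_eq ENNReal.measurable_ofReal]
    simp only [Nat.cast_one, div_one] at h
    exact h.lintegral_lt_top.ne
  | succ n ih =>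
    rw [optMin_succ n ih]
    refine ne_top_of_le_ne_top ih ((lintegral_mono fun _ => min_le_right _ _).trans ?_)
    simp

theorem IsMHR.toReal_optMin_succ (hμ : IsMHR μ) {n : ℕ} (hn : 1 ≤ n) :
    (optMin μ (n + 1)).toReal = truncMean (quantile μ) (optMin μ n).toReal := by
  obtain ⟨n, rfl⟩ := Nat.exists_eq_add_of_le' hn
  have hfin := hμ.optMin_ne_top n
  have hQ := hμ.concaveGrowth
  rw [optMin_succ n hfin, hμ.lintegral_eq (by fun_prop), truncMean]
  conv_lhs => rw [← ENNReal.ofReal_toReal hfin]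
  simp_rw [← ENNReal.ofReal_min]
  rw [← ofReal_integral_eq_lintegral_ofReal (hQ.integrable_min ENNReal.toReal_nonneg),
    ENNReal.toReal_ofReal]
  · refine integral_nonneg_of_ae ?_
    filter_upwards [ae_expLaw_pos] with v hv
    exact le_min (hQ.nonneg v hv.le) ENNReal.toReal_nonneg
  · filter_upwards [ae_expLaw_pos] with v hv
    exact le_min (hQ.nonneg v hv.le) ENNReal.toReal_nonneg

theorem IsMHR.integral_le_toReal_optMin (hμ : IsMHR μ) {n : ℕ} (hn : 1 ≤ n) :
    ∫ v, quantile μ (v / n) ∂expLaw ≤ (optMin μ n).toReal := by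
  obtain ⟨n, rfl⟩ := Nat.exists_eq_add_of_le' hn
  have h := prophetMin_le_optMin (μ := μ) n
  rw [hμ.prophetMin_eq_ofReal (by omega)] at h
  exact (ENNReal.ofReal_le_iff_le_toReal (hμ.optMin_ne_top n)).1 h

/-- Policy cost and prophet value are both compared with Q(1/n), which cancels in the quotient. -/
theorem IsMHR.exists_isMinACR (hμ : IsMHR μ) {γ : ℝ} (h : InMinDomain μ γ) :
    ∃ l : ℝ≥0∞, l ≤ 2 ∧ IsMinACR μ l := by
  have hQ := hμ.concaveGrowth
  obtain ⟨a, ha, hinc⟩ := hμ.incrementsConverge h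
  obtain ⟨g, hg0, hg1, hratio⟩ := hQ.exists_tendsto_ratio ha hinc
  refine ⟨ENNReal.ofReal ((1 + g) ^ g / Real.Gamma (1 + g)), ?_, ?_⟩
  · simpa using ENNReal.ofReal_le_ofReal (rpow_div_Gamma_le_two hg0 hg1)
  have hG : 0 < Real.Gamma (1 + g) := Real.Gamma_pos_of_pos (by linarith)
  have hm := hQ.tendsto_integral_div hg0 hratio
  have hc := hQ.tendsto_recursion_div (c := fun n => (optMin μ n).toReal)
    (fun _ => ENNReal.toReal_nonneg) (fun n hn => hμ.toReal_optMin_succ hn) hg0 hratio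
    (fun (n : ℕ) hn => hμ.integral_le_toReal_optMin hn)
  refine (ENNReal.tendsto_ofReal (hc.div hm hG.ne')).congr' ?_
  filter_upwards [eventually_ge_atTop 1, hm.eventually (lt_mem_nhds hG)] with n hn hmn
  have hn0 : (0 : ℝ) < n := by exact_mod_cast (by omega : 0 < n)
  have hq := hQ.pos (div_pos one_pos hn0)
  have hmpos := (div_pos_iff_of_pos_right hq).1 hmn
  have hfin : optMin μ n ≠ ∞ := by
    obtain ⟨n, rfl⟩ := Nat.exists_eq_add_of_le' hn
    exact hμ.optMin_ne_top n
  simp only [Pi.div_apply]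
  rw [div_div_div_cancel_right₀ hq.ne', ENNReal.ofReal_div_of_pos hmpos,
    ENNReal.ofReal_toReal hfin, hμ.prophetMin_eq_ofReal (by omega)]

theorem IsMHR.neg_one_le_of_inMinDomain (hμ : IsMHR μ) {γ : ℝ} (h : InMinDomain μ γ) : -1 ≤ γ := by
  obtain ⟨a, ha, hinc⟩ := hμ.incrementsConverge h
  exact hμ.concaveGrowth.neg_one_le ha hinc

end Main

end ProphetMHR

theorem theorem2 (μ : Measure ℝ) [IsProbabilityMeasure μ] (hμ : ProphetMHR.IsMHR μ) (γ : ℝ) :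
    (ProphetMHR.InMaxDomain μ γ → γ ≤ 0 ∧ ProphetMHR.IsMaxACR μ 1) ∧
    (ProphetMHR.InMinDomain μ γ → -1 ≤ γ ∧ ∃ l : ℝ≥0∞, l ≤ 2 ∧ ProphetMHR.IsMinACR μ l) := by
  exact ⟨fun h => ⟨hμ.nonpos_of_inMaxDomain h, hμ.isMaxACR_one⟩,
    fun h => ⟨hμ.neg_one_le_of_inMinDomain h, hμ.exists_isMinACR h⟩⟩
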